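/- Let $U\subset\mathbb{R}^m$ and $V,I\subset\mathbb{R}$ be open and connected with $0\in V$, $0\in I$, and let $G\colon U\times V\times I\to\mathbb{R}$ be $C^2$ with $G(u,0,\epsilon)=0$ for all $u\in U$, $\epsilon\in I$ and $\partial_vG(u,0,0)>0$ for all $u\in U$. Let $u_0\in U$ and let $(v_{\mathrm h},q_{\mathrm h})\colon\mathbb{R}\to V\times\mathbb{R}$ be a non-trivial solution of $$v'=q,\qquad q'=G(u_0,v,0)$$ that is homoclinic to $(0,0)$. For $\lambda\in\mathbb{C}$ consider the homogeneous fast limit problem $$\partial_x\phi=\mathcal{A}(x,\lambda)\phi,\quad \phi=(v,q)\in\mathbb{C}^2,\qquad \mathcal{A}(x,\lambda)=\begin{pmatrix}0&1\\ \partial_vG(u_0,v_{\mathrm h}(x),0)+\lambda&0\end{pmatrix}.\tag{1}$$ Let $\Lambda<0$ be such that the spectrum of $\begin{pmatrix}0&1\\ \partial_vG(u_0,0,0)+\lambda&0\end{pmatrix}$ is bounded away from the imaginary axis, uniformly in $\lambda\in\mathcal{C}_\Lambda:=\{\lambda\in\mathbb{C}:\operatorname{Re}\lambda>\Lambda\}$.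 A \emph{fast reduced Evans function} is a map $\mathcal{E}_{f,0}\colon\mathcal{C}_\Lambda\to\mathbb{C}$, $\mathcal{E}_{f,0}(\lambda)=\det(B^u(\lambda),B^s(\lambda))$, where, for $\lambda\in\mathcal{C}_\Lambda$, (1) has exponential dichotomies on $[0,\infty)$ and $(-\infty,0]$ with projections $P_+(x,\lambda)$ and $P_-(x,\lambda)$, and $B^u,B^s\colon\mathcal{C}_\Lambda\to\mathbb{C}^2$ are analytic and such that $B^u(\lambda)$ and $B^s(\lambda)$ are bases of $P_+(0,\lambda)[\mathbb{C}^2]$ and $\ker P_-(0,\lambda)$, respectively. Then a fast reduced Evans function exists, and every fast reduced Evans function $\mathcal{E}_{f,0}$ has the following properties. All zeros of $\mathcal{E}_{f,0}$ in $\mathcal{C}_\Lambda$ are real and simple. There is precisely one positive zero $\lambda_0$ of $\mathcal{E}_{f,0}$, and the $v$-component of any non-trivial bounded solution of (1) at $\lambda=\lambda_0$ has no zeros. Moreover, $0$ is a zero of $\mathcal{E}_{f,0}$, and $(v_{\mathrm h}',q_{\mathrm h}')$ spans the complex vector space of bounded solutions of (1) on $\mathbb{R}$ at $\lambda=0$.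 -/

import Mathlib

open Set Filter Topology Matrix

noncomputable section

namespace FastEvans

/-- `φ : ℝ → ℂ^ι` solves the linear system `φ' = A(x) φ` on `ℝ`. -/
def IsSolution {ι : Type*} [Fintype ι] (A : ℝ → Matrix ι ι ℂ) (φ : ℝ → ι → ℂ) : Prop :=
  ∀ x, HasDerivAt φ (A x *ᵥ φ x) x

/-- The complex vector space of bounded solutions on `ℝ` of `φ' = A(x) φ`. -/
def boundedSolutions {ι : Type*} [Fintype ι] (A : ℝ → Matrix ι ι ℂ) :
    Submodule ℂ (ℝ → ι → ℂ) where
  carrier := {φ | IsSolution A φ ∧ ∃ C : ℝ, ∀ x, ‖φ x‖ ≤ C}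
  zero_mem' := ⟨fun x => by simp, 0, fun x => by simp⟩
  add_mem' := by
    rintro φ ψ ⟨hφ, C, hC⟩ ⟨hψ, D, hD⟩
    refine ⟨fun x => ?_, C + D, fun x => (norm_add_le _ _).trans (add_le_add (hC x) (hD x))⟩
    have h := (hφ x).add (hψ x)
    rw [← mulVec_add] at h
    exact h
  smul_mem' := by
    rintro c φ ⟨hφ, C, hC⟩
    refine ⟨fun x => ?_, ‖c‖ * C, fun x => ?_⟩
    · have h := (hφ x).const_smul c
      rw [← mulVec_smul] at h
      exact h
    · simpa [norm_smul] using mul_le_mul_of_nonneg_left (hC x) (norm_nonneg c)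

/-- `T(x, y)` is the evolution operator of `φ' = A(x) φ`. -/
def IsEvolution {ι : Type*} [Fintype ι] [DecidableEq ι] (A : ℝ → Matrix ι ι ℂ)
    (T : ℝ → ℝ → Matrix ι ι ℂ) : Prop :=
  ∀ y, T y y = 1 ∧ ∀ ξ, IsSolution A (fun x => T x y *ᵥ ξ)

/-- `φ' = A(x) φ` has an exponential dichotomy on `J` with constants `K, μ > 0` and projections
`P(x)`, `x ∈ J`. The operator norm bounds are spelled out on vectors `ξ`. -/
def HasExpDichotomyOn {ι : Type*} [Fintype ι] [DecidableEq ι] (A : ℝ → Matrix ι ι ℂ)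
    (J : Set ℝ) (K μ : ℝ) (P : ℝ → Matrix ι ι ℂ) : Prop :=
  0 < K ∧ 0 < μ ∧ (∀ x ∈ J, P x * P x = P x) ∧
    ∃ T, IsEvolution A T ∧ ∀ x ∈ J, ∀ y ∈ J,
      P x * T x y = T x y * P y ∧
      (y ≤ x → ∀ ξ, ‖(T x y * P y) *ᵥ ξ‖ ≤ K * Real.exp (-μ * (x - y)) * ‖ξ‖) ∧
      (x ≤ y → ∀ ξ, ‖(T x y * (1 - P y)) *ᵥ ξ‖ ≤ K * Real.exp (-μ * (y - x)) * ‖ξ‖)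

/-- The open half plane `{ζ : Re ζ > Λ}`. -/
def halfPlane (Λ : ℝ) : Set ℂ := {ζ | Λ < ζ.re}

/-- Conditions on the reaction term `G(u, v, ε)` of the scalar fast component `v`:
`G` is `C²` on `U × V × I`, vanishes at `v = 0`, and `∂_v G(u, 0, 0)` is positive for `u ∈ U`. -/
structure ReactionTerm {m : ℕ} (U : Set (EuclideanSpace ℝ (Fin m))) (V I : Set ℝ)
    (G : EuclideanSpace ℝ (Fin m) → ℝ → ℝ → ℝ) : Prop where
  isOpen_U : IsOpen U
  isConnected_U : IsConnected U
  isOpen_V : IsOpen V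
  isConnected_V : IsConnected V
  isOpen_I : IsOpen I
  isConnected_I : IsConnected I
  zero_mem_V : (0 : ℝ) ∈ V
  zero_mem_I : (0 : ℝ) ∈ I
  contDiffOn : ContDiffOn ℝ 2
    (fun p : EuclideanSpace ℝ (Fin m) × ℝ × ℝ => G p.1 p.2.1 p.2.2) (U ×ˢ V ×ˢ I)
  vanish : ∀ u ∈ U, ∀ ε ∈ I, G u 0 ε = 0
  normally_hyperbolic : ∀ u ∈ U, 0 < deriv (fun w => G u w 0) 0

/-- `(v, q)` is a (non-trivial) solution of `v' = q`, `q' = g(v)`, `v ∈ V`,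
that is homoclinic to `(0, 0)`. -/
structure IsHomoclinic (V : Set ℝ) (g : ℝ → ℝ) (v q : ℝ → ℝ) : Prop where
  mem : ∀ x, v x ∈ V
  hasDerivAt_v : ∀ x, HasDerivAt v (q x) x
  hasDerivAt_q : ∀ x, HasDerivAt q (g (v x)) x
  v_atTop : Tendsto v atTop (𝓝 0)
  v_atBot : Tendsto v atBot (𝓝 0)
  q_atTop : Tendsto q atTop (𝓝 0)
  q_atBot : Tendsto q atBot (𝓝 0)
  nontrivial : ∃ x, (v x, q x) ≠ (0, 0)

/-- The matrix `(0, 1; ∂_v G(u, v, 0) + ζ, 0)`. -/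
def fastMatrix {m : ℕ} (G : EuclideanSpace ℝ (Fin m) → ℝ → ℝ → ℝ)
    (u : EuclideanSpace ℝ (Fin m)) (v : ℝ) (ζ : ℂ) : Matrix (Fin 2) (Fin 2) ℂ :=
  !![0, 1; ((deriv (fun w => G u w 0) v : ℝ) : ℂ) + ζ, 0]

/-- The spectrum of the asymptotic matrix `(0, 1; ∂_v G(u, 0, 0) + ζ, 0)` is bounded away from the
imaginary axis, uniformly in `ζ` with `Re ζ > Λ`. -/
def UniformlyHyperbolic {m : ℕ} (G : EuclideanSpace ℝ (Fin m) → ℝ → ℝ → ℝ)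
    (u : EuclideanSpace ℝ (Fin m)) (Λ : ℝ) : Prop :=
  ∃ δ > 0, ∀ ζ ∈ halfPlane Λ, ∀ μ ∈ spectrum ℂ (fastMatrix G u 0 ζ), δ ≤ |μ.re|

/-- `E` is a fast reduced Evans function on `{Re ζ > Λ}` of the planar family
`φ' = A(x, ζ) φ`: `E(ζ) = det (Bu(ζ), Bs(ζ))`, where `Bu`, `Bs` are analytic bases of the range of
`Pp(0, ζ)` and of the kernel of `Pm(0, ζ)`, with `Pp`, `Pm` projections of exponential dichotomies
on `[0, ∞)` and `(-∞, 0]`. (That range and that kernel do not depend on the choice of `Pp`, `Pm`.) -/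
def IsFastReducedEvans (A : ℂ → ℝ → Matrix (Fin 2) (Fin 2) ℂ) (Λ : ℝ) (E : ℂ → ℂ) : Prop :=
  ∃ (Pp Pm : ℂ → ℝ → Matrix (Fin 2) (Fin 2) ℂ) (Bu Bs : ℂ → Fin 2 → ℂ),
    (∀ ζ ∈ halfPlane Λ, ∃ K μ, HasExpDichotomyOn (A ζ) (Ici 0) K μ (Pp ζ)) ∧
    (∀ ζ ∈ halfPlane Λ, ∃ K μ, HasExpDichotomyOn (A ζ) (Iic 0) K μ (Pm ζ)) ∧
    AnalyticOnNhd ℂ Bu (halfPlane Λ) ∧ AnalyticOnNhd ℂ Bs (halfPlane Λ) ∧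
    ∀ ζ ∈ halfPlane Λ,
      Bu ζ ≠ 0 ∧ Submodule.span ℂ {Bu ζ} = LinearMap.range (Pp ζ 0).mulVecLin ∧
      Bs ζ ≠ 0 ∧ Submodule.span ℂ {Bs ζ} = LinearMap.ker (Pm ζ 0).mulVecLin ∧
      E ζ = Matrix.det (Matrix.of ![Bu ζ, Bs ζ])ᵀ

end FastEvans

end

/-!
For large `R` the real part of `conj v * q` (`lyap`) increases strictly along every non-trivial
solution `(v, q)` outside `[-R, R]`. Hence for each `ζ` in the half-plane there are solutions
decaying at `+∞` and at `-∞`, unique up to scalars; the bounded solutions are those which decay at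
both ends, and the two exponential dichotomies are read off from the decaying solutions. These can
be normalised so as to be analytic in `ζ`, and every fast reduced Evans function is their Wronskian
up to a non-vanishing factor. Its zeros are therefore the eigenvalues of the Schrödinger operator
`∂² - a` with `a = ∂_v G(u₀, v_h, 0)`.

Lagrange's identity makes the eigenvalues real and shows that at an eigenvalue the derivative of
the Wronskian is a non-zero multiple of `∫ v²`, so the zeros are simple.

The derivative of the homoclinic orbit is an eigenfunction at `0` whose `v`-component has exactly
one zero. By Sturm comparison, eigenfunctions at positive eigenvalues have no zeros at all, and two
of these could not be orthogonal, which leaves at most one positive eigenvalue. One exists by the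
intermediate value theorem: normalised to be positive for large `ζ`, the Wronskian is decreasing
on the real axis at its zero `0`, because the eigenfunction there changes sign.
-/

open MeasureTheory

noncomputable section

open scoped BoundedContinuousFunction ComplexConjugate ComplexOrder

namespace FastEvans

section GlobalExistence

variable {E : Type*} [NormedAddCommGroup E] [NormedSpace ℝ E]

lemma norm_intervalIntegral_le_of_norm_le_exp {f : ℝ → E} {C K : ℝ} (hK : 0 < K)
    (hf : ∀ y, ‖f y‖ ≤ C * Real.exp (K * |y|)) (x : ℝ) :
    ‖∫ y in (0 : ℝ)..x, f y‖ ≤ C / K * Real.exp (K * |x|) := by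
  have hC : 0 ≤ C := nonneg_of_mul_nonneg_left ((norm_nonneg _).trans (hf 0)) (Real.exp_pos _)
  have of_nonneg : ∀ {h : ℝ → E}, (∀ y, ‖h y‖ ≤ C * Real.exp (K * |y|)) → ∀ {z : ℝ}, 0 ≤ z →
      ‖∫ y in (0 : ℝ)..z, h y‖ ≤ C / K * Real.exp (K * z) := fun {h} hh z hz =>
    calc ‖∫ y in (0 : ℝ)..z, h y‖ ≤ ∫ y in (0 : ℝ)..z, C * Real.exp (K * y) :=
          intervalIntegral.norm_integral_le_of_norm_le hz
            (ae_of_all _ fun y hy => by simpa [abs_of_pos hy.1] using hh y)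
            (Continuous.intervalIntegrable (by fun_prop) _ _)
      _ = C / K * Real.exp (K * z) - C / K := by
          rw [intervalIntegral.integral_const_mul, intervalIntegral.integral_comp_mul_left _ hK.ne',
            integral_exp, mul_zero, Real.exp_zero, smul_eq_mul]
          ring
      _ ≤ C / K * Real.exp (K * z) := sub_le_self _ (by positivity)
  rcases le_total 0 x with hx | hx
  · simpa only [abs_of_nonneg hx] using of_nonneg hf hx
  · have h := of_nonneg (h := fun y => f (-y)) (by simpa using fun y => hf (-y))
      (neg_nonneg.2 hx)
    rw [intervalIntegral.integral_comp_neg, neg_neg, neg_zero, intervalIntegral.integral_symm,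
      norm_neg] at h
    rwa [abs_of_nonpos hx]

lemma norm_exp_smul_integral_clm_le {A : ℝ → E →L[ℝ] E} {M : ℝ} (hM : 0 < M)
    (hAM : ∀ x, ‖A x‖ ≤ M) {ψ : ℝ → E} {C : ℝ} (hψ : ∀ y, ‖ψ y‖ ≤ C) (x : ℝ) :
    ‖Real.exp (-(2 * M * |x|)) • ∫ y in (0 : ℝ)..x, A y (Real.exp (2 * M * |y|) • ψ y)‖ ≤
      1 / 2 * C := by
  have integrand_le : ∀ y, ‖A y (Real.exp (2 * M * |y|) • ψ y)‖ ≤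
      M * C * Real.exp (2 * M * |y|) := fun y =>
    calc ‖A y (Real.exp (2 * M * |y|) • ψ y)‖ ≤ M * ‖Real.exp (2 * M * |y|) • ψ y‖ :=
          (A y).le_of_opNorm_le (hAM y) _
      _ = M * (Real.exp (2 * M * |y|) * ‖ψ y‖) := by rw [norm_smul, Real.norm_eq_abs, Real.abs_exp]
      _ ≤ M * (Real.exp (2 * M * |y|) * C) := by gcongr; exact hψ y
      _ = M * C * Real.exp (2 * M * |y|) := by ring
  rw [norm_smul, Real.norm_eq_abs, Real.abs_exp]
  calc _ ≤ Real.exp (-(2 * M * |x|)) * (M * C / (2 * M) * Real.exp (2 * M * |x|)) := by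
          gcongr
          exact norm_intervalIntegral_le_of_norm_le_exp (by positivity) integrand_le x
    _ = 1 / 2 * C := by rw [Real.exp_neg]; field_simp

/-- The Volterra operator `φ ↦ ∫₀ˣ A(y) φ(y) dy` of a field with `‖A‖ ≤ M`, conjugated by the weight
`exp (2 M |x|)` so that it has norm at most `1 / 2` on bounded continuous functions. -/
def weightedVolterra {A : ℝ → E →L[ℝ] E} (hA : Continuous A) {M : ℝ} (hM : 0 < M)
    (hAM : ∀ x, ‖A x‖ ≤ M) : (ℝ →ᵇ E) →L[ℝ] (ℝ →ᵇ E) :=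
  have cont (ψ : ℝ →ᵇ E) : Continuous fun y => A y (Real.exp (2 * M * |y|) • ψ y) :=
    hA.clm_apply ((by fun_prop : Continuous fun y : ℝ => Real.exp (2 * M * |y|)).smul ψ.continuous)
  have bound (ψ : ℝ →ᵇ E) := norm_exp_smul_integral_clm_le hM hAM ψ.norm_coe_le_norm
  LinearMap.mkContinuous
    { toFun := fun ψ => .ofNormedAddCommGroup
        (fun x => Real.exp (-(2 * M * |x|)) •
          ∫ y in (0 : ℝ)..x, A y (Real.exp (2 * M * |y|) • ψ y))
        ((by fun_prop : Continuous fun x : ℝ => Real.exp (-(2 * M * |x|))).smul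
          (intervalIntegral.continuous_primitive
            (fun _ _ => (cont ψ).intervalIntegrable _ _) 0))
        (1 / 2 * ‖ψ‖) (bound ψ)
      map_add' := fun ψ₁ ψ₂ => by
        ext x
        have h := intervalIntegral.integral_add ((cont ψ₁).intervalIntegrable (μ := volume) 0 x)
          ((cont ψ₂).intervalIntegrable 0 x)
        simp only [← map_add, ← smul_add] at h
        simp only [BoundedContinuousFunction.coe_ofNormedAddCommGroup,
          BoundedContinuousFunction.add_apply, h]
        exact smul_add _ _ _
      map_smul' := fun c ψ => by
        ext x
        simp only [BoundedContinuousFunction.coe_ofNormedAddCommGroup,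
          BoundedContinuousFunction.smul_apply, smul_comm _ c, map_smul, RingHom.id_apply,
          intervalIntegral.integral_smul] }
    (1 / 2) fun ψ => (BoundedContinuousFunction.norm_le (by positivity)).2 (bound ψ)

lemma norm_weightedVolterra_lt_one {A : ℝ → E →L[ℝ] E} (hA : Continuous A) {M : ℝ} (hM : 0 < M)
    (hAM : ∀ x, ‖A x‖ ≤ M) : ‖weightedVolterra hA hM hAM‖ < 1 :=
  (ContinuousLinearMap.opNorm_le_bound _ one_half_pos.le fun ψ =>
    (BoundedContinuousFunction.norm_le (by positivity)).2
      (norm_exp_smul_integral_clm_le hM hAM ψ.norm_coe_le_norm)).trans_lt one_half_lt_one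

theorem exists_forall_hasDerivAt_linear [CompleteSpace E] {A : ℝ → E →L[ℝ] E} (hA : Continuous A)
    {M : ℝ} (hAM : ∀ x, ‖A x‖ ≤ M) (y : ℝ) (ξ : E) :
    ∃ φ : ℝ → E, φ y = ξ ∧ ∀ x, HasDerivAt φ (A x (φ x)) x := by
  wlog hy : y = 0 generalizing y A
  · obtain ⟨φ, h0, hφ⟩ := this (A := fun x => A (x + y)) (by fun_prop) (fun x => hAM _) 0 rfl
    refine ⟨fun x => φ (x - y), by simpa using h0, fun x => ?_⟩
    simpa using (hφ (x - y)).comp_sub_const x y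
  subst hy
  have hM : 0 < M + 1 := by linarith [(norm_nonneg _).trans (hAM 0)]
  have hAM' : ∀ x, ‖A x‖ ≤ M + 1 := fun x => (hAM x).trans (by linarith)
  have hw : Continuous fun x : ℝ => Real.exp (-(2 * (M + 1) * |x|)) := by fun_prop
  let ψ₀ : ℝ →ᵇ E := .ofNormedAddCommGroup (fun x => Real.exp (-(2 * (M + 1) * |x|)) • ξ)
    (hw.smul continuous_const) ‖ξ‖ fun x => by
      rw [norm_smul, Real.norm_eq_abs, Real.abs_exp]
      exact mul_le_of_le_one_left (norm_nonneg _)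
        (Real.exp_le_one_iff.2 (neg_nonpos.2 (by positivity)))
  obtain ⟨ψ, hψ⟩ : ∃ ψ, (1 - weightedVolterra hA hM hAM') ψ = ψ₀ :=
    (ContinuousLinearMap.isUnit_iff_bijective.1
      (isUnit_one_sub_of_norm_lt_one (norm_weightedVolterra_lt_one hA hM hAM'))).2 ψ₀
  set φ : ℝ → E := fun x => Real.exp (2 * (M + 1) * |x|) • ψ x
  have hφc : Continuous fun x => A x (φ x) := hA.clm_apply
    ((by fun_prop : Continuous fun x : ℝ => Real.exp (2 * (M + 1) * |x|)).smul ψ.continuous)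
  have integral_eq : φ = fun x => ξ + ∫ y in (0 : ℝ)..x, A y (φ y) := by
    funext x
    have h : ψ x = Real.exp (-(2 * (M + 1) * |x|)) • (ξ + ∫ y in (0 : ℝ)..x, A y (φ y)) := by
      rw [smul_add, ← sub_eq_iff_eq_add]
      exact congrArg (· x) hψ
    simp only [φ]
    rw [h, smul_smul, ← Real.exp_add, add_neg_cancel, Real.exp_zero, one_smul]
  refine ⟨φ, by rw [integral_eq]; simp, fun x => ?_⟩
  have h := (intervalIntegral.integral_hasDerivAt_right (hφc.intervalIntegrable 0 x)
    (hφc.stronglyMeasurableAtFilter _ _) hφc.continuousAt).const_add ξ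
  rwa [← integral_eq] at h

end GlobalExistence

lemma norm_le_exp_mul_norm_of_norm_deriv_le {E : Type*} [NormedAddCommGroup E] [NormedSpace ℝ E]
    {f f' : ℝ → E} {M : ℝ} (hf : ∀ x, HasDerivAt f (f' x) x) (hM : ∀ x, ‖f' x‖ ≤ M * ‖f x‖)
    (x y : ℝ) : ‖f x‖ ≤ Real.exp (M * |x - y|) * ‖f y‖ := by
  have forward : ∀ {g g' : ℝ → E}, (∀ x, HasDerivAt g (g' x) x) →
      (∀ x, ‖g' x‖ ≤ M * ‖g x‖) → ∀ {x y : ℝ}, y ≤ x →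
      ‖g x‖ ≤ Real.exp (M * (x - y)) * ‖g y‖ := fun {g g'} hg hgM {x y} hyx => by
    have h := norm_le_gronwallBound_of_norm_deriv_right_le (ε := 0)
      (fun z _ => (hg z).continuousAt.continuousWithinAt) (fun z _ => (hg z).hasDerivWithinAt)
      le_rfl (fun z _ => by simpa using hgM z) x ⟨hyx, le_rfl⟩
    rwa [gronwallBound_ε0, mul_comm] at h
  rcases le_total y x with hyx | hxy
  · simpa only [abs_of_nonneg (sub_nonneg.2 hyx)] using forward hf hM hyx
  · have h := forward (g := fun z => f (-z)) (g' := fun z => -f' (-z))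
      (fun z => by simpa [Function.comp_def] using (hf (-z)).scomp z (hasDerivAt_neg z))
      (fun z => by simpa using hM (-z)) (neg_le_neg hxy)
    simpa only [neg_neg, abs_of_nonpos (sub_nonpos.2 hxy), neg_sub, sub_neg_eq_add,
      neg_add_eq_sub] using h

section LinearSystem

variable {ι : Type*} [Fintype ι] {A : ℝ → Matrix ι ι ℂ} {φ ψ : ℝ → ι → ℂ} {M : ℝ}

theorem exists_isSolution (hA : Continuous A) (hM : ∀ x ξ, ‖A x *ᵥ ξ‖ ≤ M * ‖ξ‖) (y : ℝ)
    (ξ : ι → ℂ) : ∃ φ, IsSolution A φ ∧ φ y = ξ := by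
  classical
  let toCLM : Matrix ι ι ℂ →ₗ[ℝ] (ι → ℂ) →L[ℝ] (ι → ℂ) :=
    LinearMap.toContinuousLinearMap.toLinearMap ∘ₗ
      (LinearMap.restrictScalarsₗ ℝ ℂ (ι → ℂ) (ι → ℂ) ℝ) ∘ₗ
      (Matrix.toLin'.toLinearMap.restrictScalars ℝ)
  have hA' : Continuous fun x => toCLM (A x) :=
    (LinearMap.continuous_of_finiteDimensional toCLM).comp hA
  obtain ⟨φ, hy, hφ⟩ := exists_forall_hasDerivAt_linear hA' (M := max M 0)
    (fun x => ContinuousLinearMap.opNorm_le_bound _ (le_max_right _ _) fun η =>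
      (hM x η).trans (by gcongr; exact le_max_left _ _)) y ξ
  exact ⟨φ, hφ, hy⟩

namespace IsSolution

lemma continuous (hφ : IsSolution A φ) : Continuous φ :=
  continuous_iff_continuousAt.2 fun x => (hφ x).continuousAt

lemma add (hφ : IsSolution A φ) (hψ : IsSolution A ψ) : IsSolution A (φ + ψ) := fun x => by
  simpa only [Pi.add_apply, mulVec_add] using (hφ x).add (hψ x)

lemma const_smul (hφ : IsSolution A φ) (k : ℂ) : IsSolution A (k • φ) := fun x => by
  simpa only [Pi.smul_apply, mulVec_smul] using (hφ x).const_smul k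

lemma norm_le_exp (hφ : IsSolution A φ) (hM : ∀ x ξ, ‖A x *ᵥ ξ‖ ≤ M * ‖ξ‖) (x y : ℝ) :
    ‖φ x‖ ≤ Real.exp (M * |x - y|) * ‖φ y‖ :=
  norm_le_exp_mul_norm_of_norm_deriv_le hφ (fun x => hM x _) x y

lemma eq_zero_of_apply_eq_zero (hφ : IsSolution A φ) (hM : ∀ x ξ, ‖A x *ᵥ ξ‖ ≤ M * ‖ξ‖) {y : ℝ}
    (hy : φ y = 0) : φ = 0 := by
  funext x
  simpa [hy] using hφ.norm_le_exp hM x y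

lemma eq_of_apply_eq (hφ : IsSolution A φ) (hψ : IsSolution A ψ)
    (hM : ∀ x ξ, ‖A x *ᵥ ξ‖ ≤ M * ‖ξ‖) {y : ℝ} (hy : φ y = ψ y) : φ = ψ := by
  have h := (hφ.add (hψ.const_smul (-1))).eq_zero_of_apply_eq_zero hM (y := y) (by simp [hy])
  rwa [neg_one_smul, add_neg_eq_zero] at h

end IsSolution

/-- `φ` is bounded on `J`. -/
def IsBoundedOn (φ : ℝ → ι → ℂ) (J : Set ℝ) : Prop := ∃ C, ∀ x ∈ J, ‖φ x‖ ≤ C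

namespace IsBoundedOn

variable {J : Set ℝ}

lemma add (hφ : IsBoundedOn φ J) (hψ : IsBoundedOn ψ J) : IsBoundedOn (φ + ψ) J := by
  obtain ⟨C, hC⟩ := hφ
  obtain ⟨D, hD⟩ := hψ
  exact ⟨C + D, fun x hx => norm_add_le_of_le (hC x hx) (hD x hx)⟩

lemma const_smul (hφ : IsBoundedOn φ J) (k : ℂ) : IsBoundedOn (k • φ) J := by
  obtain ⟨C, hC⟩ := hφ
  exact ⟨‖k‖ * C, fun x hx => by
    rw [Pi.smul_apply, norm_smul]
    exact mul_le_mul_of_nonneg_left (hC x hx) (norm_nonneg k)⟩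

end IsBoundedOn

/-- The initial data at `0` of the solutions of `φ' = A(x) φ` on `ℝ` that are bounded on `J`. For
`J = [0, ∞)` and `J = (-∞, 0]` these are the stable and the unstable subspace at `0`. -/
def boundedInitialData (A : ℝ → Matrix ι ι ℂ) (J : Set ℝ) : Submodule ℂ (ι → ℂ) where
  carrier := {ξ | ∃ φ, IsSolution A φ ∧ IsBoundedOn φ J ∧ φ 0 = ξ}
  zero_mem' := ⟨0, fun x => by simp, ⟨0, by simp⟩, rfl⟩
  add_mem' := by
    rintro _ _ ⟨φ, hφ, hφb, rfl⟩ ⟨ψ, hψ, hψb, rfl⟩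
    exact ⟨φ + ψ, hφ.add hψ, hφb.add hψb, rfl⟩
  smul_mem' := by
    rintro k _ ⟨φ, hφ, hφb, rfl⟩
    exact ⟨k • φ, hφ.const_smul k, hφb.const_smul k, rfl⟩

section Dichotomy

variable [DecidableEq ι] {P : ℝ → Matrix ι ι ℂ} {K μ : ℝ}

lemma IsEvolution.mulVec_eq {T : ℝ → ℝ → Matrix ι ι ℂ} (hT : IsEvolution A T)
    (hM : ∀ x ξ, ‖A x *ᵥ ξ‖ ≤ M * ‖ξ‖) (hφ : IsSolution A φ) (x y : ℝ) :
    T x y *ᵥ φ y = φ x :=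
  congrFun (((hT y).2 (φ y)).eq_of_apply_eq hφ hM (y := y) (by rw [(hT y).1, one_mulVec])) x

lemma eq_zero_of_forall_norm_le_mul_exp {E : Type*} [NormedAddCommGroup E] {ξ : E} {C μ : ℝ}
    (hμ : 0 < μ) (h : ∀ s, 0 ≤ s → ‖ξ‖ ≤ C * Real.exp (-μ * s)) : ξ = 0 := by
  have hlim : Tendsto (fun s => C * Real.exp (-μ * s)) atTop (𝓝 (C * 0)) :=
    (Real.tendsto_exp_atBot.comp
      (tendsto_id.const_mul_atTop_of_neg (neg_neg_iff_pos.2 hμ))).const_mul C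
  rw [mul_zero] at hlim
  exact norm_le_zero_iff.1 (ge_of_tendsto hlim (eventually_ge_atTop 0 |>.mono h))

theorem HasExpDichotomyOn.range_eq (hP : HasExpDichotomyOn A (Ici 0) K μ P)
    (hM : ∀ x ξ, ‖A x *ᵥ ξ‖ ≤ M * ‖ξ‖) :
    LinearMap.range (P 0).mulVecLin = boundedInitialData A (Ici 0) := by
  obtain ⟨hK, hμ, -, T, hT, hTP⟩ := hP
  have h0 : (0 : ℝ) ∈ Ici (0 : ℝ) := self_mem_Ici
  ext ξ
  constructor
  · rintro ⟨η, rfl⟩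
    refine ⟨fun x => T x 0 *ᵥ (P 0 *ᵥ η), (hT 0).2 _, ⟨K * ‖η‖, fun x hx => ?_⟩,
      by simp [(hT 0).1]⟩
    beta_reduce
    rw [mulVec_mulVec]
    refine ((hTP x hx 0 h0).2.1 hx η).trans (mul_le_mul_of_nonneg_right ?_ (norm_nonneg η))
    exact mul_le_of_le_one_right hK.le (Real.exp_le_one_iff.2 (by nlinarith [mem_Ici.1 hx]))
  · rintro ⟨φ, hφ, ⟨C, hC⟩, rfl⟩
    have hzero : (1 - P 0) *ᵥ φ 0 = 0 := by
      refine eq_zero_of_forall_norm_le_mul_exp (C := K * C) hμ fun s hs => ?_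
      have hcomm : (1 - P 0) *ᵥ φ 0 = (T 0 s * (1 - P s)) *ᵥ φ s := by
        rw [mul_sub, mul_one, ← (hTP 0 h0 s hs).1, sub_mulVec, sub_mulVec, ← mulVec_mulVec,
          hT.mulVec_eq hM hφ, one_mulVec]
      calc ‖(1 - P 0) *ᵥ φ 0‖ ≤ K * Real.exp (-μ * (s - 0)) * ‖φ s‖ :=
            hcomm ▸ (hTP 0 h0 s hs).2.2 hs (φ s)
        _ ≤ K * Real.exp (-μ * (s - 0)) * C := by gcongr; exact hC s hs
        _ = K * C * Real.exp (-μ * s) := by rw [sub_zero]; ring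
    refine ⟨φ 0, ?_⟩
    rw [sub_mulVec, one_mulVec, sub_eq_zero] at hzero
    rw [mulVecLin_apply, ← hzero]

theorem HasExpDichotomyOn.ker_eq (hP : HasExpDichotomyOn A (Iic 0) K μ P)
    (hM : ∀ x ξ, ‖A x *ᵥ ξ‖ ≤ M * ‖ξ‖) :
    LinearMap.ker (P 0).mulVecLin = boundedInitialData A (Iic 0) := by
  obtain ⟨hK, hμ, -, T, hT, hTP⟩ := hP
  have h0 : (0 : ℝ) ∈ Iic (0 : ℝ) := self_mem_Iic
  ext ξ
  rw [LinearMap.mem_ker, mulVecLin_apply]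
  constructor
  · intro hξ
    refine ⟨fun x => T x 0 *ᵥ ξ, (hT 0).2 ξ, ⟨K * ‖ξ‖, fun x hx => ?_⟩,
      by simp [(hT 0).1]⟩
    have h := (hTP x hx 0 h0).2.2 hx ξ
    rw [← mulVec_mulVec, sub_mulVec, one_mulVec, hξ, sub_zero] at h
    refine h.trans (mul_le_mul_of_nonneg_right ?_ (norm_nonneg ξ))
    exact mul_le_of_le_one_right hK.le (Real.exp_le_one_iff.2 (by nlinarith [mem_Iic.1 hx]))
  · rintro ⟨φ, hφ, ⟨C, hC⟩, rfl⟩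
    refine eq_zero_of_forall_norm_le_mul_exp (C := K * C) hμ fun s hs => ?_
    have hs' : -s ∈ Iic (0 : ℝ) := neg_nonpos.2 hs
    have hcomm : P 0 *ᵥ φ 0 = (T 0 (-s) * P (-s)) *ᵥ φ (-s) := by
      rw [← (hTP 0 h0 _ hs').1, ← mulVec_mulVec, hT.mulVec_eq hM hφ]
    calc ‖P 0 *ᵥ φ 0‖ ≤ K * Real.exp (-μ * (0 - -s)) * ‖φ (-s)‖ :=
          hcomm ▸ (hTP 0 h0 _ hs').2.1 hs' (φ (-s))
      _ ≤ K * Real.exp (-μ * (0 - -s)) * C := by gcongr; exact hC _ hs'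
      _ = K * C * Real.exp (-μ * s) := by rw [zero_sub, neg_neg]; ring

end Dichotomy

end LinearSystem

section Wronskian

/-- The determinant of the matrix with columns `ξ` and `η`. Along two solutions of a planar system
it is their Wronskian. -/
def wronskian (ξ η : Fin 2 → ℂ) : ℂ := ξ 0 * η 1 - ξ 1 * η 0

variable {ξ η : Fin 2 → ℂ}

lemma det_transpose_of_eq_wronskian (ξ η : Fin 2 → ℂ) :
    (Matrix.of ![ξ, η])ᵀ.det = wronskian ξ η := by
  simp [det_fin_two, wronskian, mul_comm]

lemma wronskian_swap (ξ η : Fin 2 → ℂ) : wronskian ξ η = -wronskian η ξ := by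
  simp only [wronskian]; ring

lemma wronskian_smul_left (k : ℂ) (ξ η : Fin 2 → ℂ) :
    wronskian (k • ξ) η = k * wronskian ξ η := by
  simp only [wronskian, Pi.smul_apply, smul_eq_mul]; ring

lemma wronskian_smul_right (k : ℂ) (ξ η : Fin 2 → ℂ) :
    wronskian ξ (k • η) = k * wronskian ξ η := by
  simp only [wronskian, Pi.smul_apply, smul_eq_mul]; ring

lemma norm_wronskian_le (ξ η : Fin 2 → ℂ) : ‖wronskian ξ η‖ ≤ 2 * ‖ξ‖ * ‖η‖ :=
  calc ‖wronskian ξ η‖ ≤ ‖ξ 0‖ * ‖η 1‖ + ‖ξ 1‖ * ‖η 0‖ := by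
        simpa only [wronskian, norm_mul] using norm_sub_le (ξ 0 * η 1) (ξ 1 * η 0)
    _ ≤ ‖ξ‖ * ‖η‖ + ‖ξ‖ * ‖η‖ := by gcongr <;> exact norm_le_pi_norm _ _
    _ = 2 * ‖ξ‖ * ‖η‖ := by ring

lemma exists_eq_smul_of_wronskian_eq_zero (hξ : ξ ≠ 0) (h : wronskian ξ η = 0) :
    ∃ k : ℂ, η = k • ξ := by
  rw [wronskian, sub_eq_zero] at h
  by_cases h0 : ξ 0 = 0
  · have h1 : ξ 1 ≠ 0 := fun h1 => hξ (by ext i; fin_cases i <;> assumption)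
    have hη : η 0 = 0 := by simpa [h0, h1] using h
    exact ⟨η 1 / ξ 1, by ext i; fin_cases i <;> simp [h0, hη, h1]⟩
  · refine ⟨η 0 / ξ 0, ?_⟩
    ext i
    fin_cases i
    · simp [h0]
    · simp only [Fin.mk_one, Pi.smul_apply, smul_eq_mul]
      field_simp
      linear_combination h

/-- The vector `η^⊥` with `η^⊥ · ξ = wronskian ξ η`. -/
def perp (η : Fin 2 → ℂ) : Fin 2 → ℂ := ![η 1, -η 0]

lemma perp_dotProduct (ξ η : Fin 2 → ℂ) : perp η ⬝ᵥ ξ = wronskian ξ η := by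
  simp only [perp, wronskian, dotProduct, Fin.sum_univ_two, cons_val_zero, cons_val_one]; ring

lemma vecMulVec_perp_mulVec (ξ η ζ : Fin 2 → ℂ) :
    vecMulVec ξ (perp η) *ᵥ ζ = wronskian ζ η • ξ := by
  rw [vecMulVec_mulVec, perp_dotProduct, op_smul_eq_smul]

lemma vecMulVec_perp_mul_vecMulVec (ξ η ζ θ : Fin 2 → ℂ) :
    vecMulVec ξ (perp η) * vecMulVec ζ θ = wronskian ζ η • vecMulVec ξ θ := by
  rw [vecMulVec_mul_vecMulVec, perp_dotProduct, vecMulVec_smul]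

lemma vecMulVec_perp_sub_vecMulVec_perp (ξ η : Fin 2 → ℂ) :
    vecMulVec ξ (perp η) - vecMulVec η (perp ξ) = wronskian ξ η • 1 := by
  ext i j
  fin_cases i <;> fin_cases j <;> simp [perp, wronskian] <;> ring

end Wronskian

section PlanarDichotomy

variable {A : ℝ → Matrix (Fin 2) (Fin 2) ℂ} {φ₁ φ₂ : ℝ → Fin 2 → ℂ} {J : Set ℝ} {K μ : ℝ}

theorem isEvolution_of_wronskian_eq_one (h₁ : IsSolution A φ₁) (h₂ : IsSolution A φ₂)
    (hw : ∀ x, wronskian (φ₁ x) (φ₂ x) = 1) :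
    IsEvolution A fun x y => vecMulVec (φ₁ x) (perp (φ₂ y)) - vecMulVec (φ₂ x) (perp (φ₁ y)) := by
  refine fun y =>
    ⟨(vecMulVec_perp_sub_vecMulVec_perp _ _).trans (by rw [hw, one_smul]), fun ξ => ?_⟩
  convert (h₁.const_smul (wronskian ξ (φ₂ y))).add (h₂.const_smul (-wronskian ξ (φ₁ y))) using 1
  funext x
  rw [sub_mulVec, vecMulVec_perp_mulVec, vecMulVec_perp_mulVec, sub_eq_add_neg, ← neg_smul]
  rfl

theorem hasExpDichotomyOn_of_wronskian_eq_one (h₁ : IsSolution A φ₁) (h₂ : IsSolution A φ₂)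
    (hw : ∀ x, wronskian (φ₁ x) (φ₂ x) = 1) (hK : 0 < K) (hμ : 0 < μ)
    (hbd : ∀ x ∈ J, ∀ y ∈ J, y ≤ x → ‖φ₁ x‖ * ‖φ₂ y‖ ≤ K * Real.exp (-μ * (x - y))) :
    HasExpDichotomyOn A J (2 * K) μ fun x => vecMulVec (φ₁ x) (perp (φ₂ x)) := by
  have hw₁ : ∀ x, wronskian (φ₁ x) (φ₁ x) = 0 := fun x => by rw [wronskian]; ring
  have hw₂ : ∀ x, wronskian (φ₂ x) (φ₂ x) = 0 := fun x => by rw [wronskian]; ring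
  have rank_one_le : ∀ (ξ η ζ : Fin 2 → ℂ) {e : ℝ}, ‖ξ‖ * ‖η‖ ≤ K * e →
      ‖vecMulVec ξ (perp η) *ᵥ ζ‖ ≤ 2 * K * e * ‖ζ‖ := fun ξ η ζ e he => by
    rw [vecMulVec_perp_mulVec, norm_smul]
    calc ‖wronskian ζ η‖ * ‖ξ‖ ≤ 2 * ‖ζ‖ * ‖η‖ * ‖ξ‖ := by gcongr; exact norm_wronskian_le ζ η
      _ = 2 * ‖ζ‖ * (‖ξ‖ * ‖η‖) := by ring
      _ ≤ 2 * ‖ζ‖ * (K * e) := by gcongr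
      _ = 2 * K * e * ‖ζ‖ := by ring
  refine ⟨by positivity, hμ, fun x _ => by rw [vecMulVec_perp_mul_vecMulVec, hw, one_smul], _,
    isEvolution_of_wronskian_eq_one h₁ h₂ hw, fun x hx y hy => ?_⟩
  have hTP : (vecMulVec (φ₁ x) (perp (φ₂ y)) - vecMulVec (φ₂ x) (perp (φ₁ y))) *
      vecMulVec (φ₁ y) (perp (φ₂ y)) = vecMulVec (φ₁ x) (perp (φ₂ y)) := by
    rw [sub_mul, vecMulVec_perp_mul_vecMulVec, vecMulVec_perp_mul_vecMulVec, hw, hw₁, one_smul,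
      zero_smul, sub_zero]
  refine ⟨?_, fun hyx ξ => ?_, fun hxy ξ => ?_⟩
  · rw [hTP, mul_sub, vecMulVec_perp_mul_vecMulVec, vecMulVec_perp_mul_vecMulVec, hw, hw₂,
      one_smul, zero_smul, sub_zero]
  · rw [hTP]
    exact rank_one_le _ _ ξ (hbd x hx y hy hyx)
  · rw [mul_sub, mul_one, hTP, sub_sub_cancel_left, neg_mulVec, norm_neg]
    exact rank_one_le _ _ ξ (mul_comm ‖φ₂ x‖ _ ▸ hbd y hy x hx hxy)

end PlanarDichotomy

section Schrodinger

/-- The matrix of the first order system `v' = q`, `q' = (a(x) + ζ) v`. -/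
def schrodingerMatrix (a : ℝ → ℝ) (ζ : ℂ) (x : ℝ) : Matrix (Fin 2) (Fin 2) ℂ :=
  !![0, 1; (a x : ℂ) + ζ, 0]

variable {a : ℝ → ℝ} {A : ℝ} {ζ ζ₁ ζ₂ : ℂ} {φ φ₁ φ₂ : ℝ → Fin 2 → ℂ}

lemma schrodingerMatrix_mulVec (a : ℝ → ℝ) (ζ : ℂ) (x : ℝ) (ξ : Fin 2 → ℂ) :
    schrodingerMatrix a ζ x *ᵥ ξ = ![ξ 1, (a x + ζ) * ξ 0] := by
  ext i
  fin_cases i <;> simp [schrodingerMatrix, mulVec, dotProduct, Fin.sum_univ_two]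

lemma isSolution_schrodingerMatrix_iff : IsSolution (schrodingerMatrix a ζ) φ ↔
    (∀ x, HasDerivAt (fun x => φ x 0) (φ x 1) x) ∧
      ∀ x, HasDerivAt (fun x => φ x 1) ((a x + ζ) * φ x 0) x := by
  simp only [IsSolution, schrodingerMatrix_mulVec, hasDerivAt_pi, Fin.forall_fin_two,
    cons_val_zero, cons_val_one, forall_and]

lemma norm_schrodingerMatrix_mulVec_le (hA : ∀ x, |a x| ≤ A) {t : ℝ} (hζ : ‖ζ‖ ≤ t) (x : ℝ)
    (ξ : Fin 2 → ℂ) : ‖schrodingerMatrix a ζ x *ᵥ ξ‖ ≤ (1 + A + t) * ‖ξ‖ := by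
  have hA0 : 0 ≤ A := (abs_nonneg _).trans (hA x)
  have ht0 : 0 ≤ t := (norm_nonneg _).trans hζ
  have h0 : ‖ξ 0‖ ≤ ‖ξ‖ := norm_le_pi_norm ξ 0
  have h1 : ‖ξ 1‖ ≤ ‖ξ‖ := norm_le_pi_norm ξ 1
  rw [schrodingerMatrix_mulVec, pi_norm_le_iff_of_nonneg (by positivity), Fin.forall_fin_two]
  constructor
  · exact h1.trans (le_mul_of_one_le_left (norm_nonneg ξ) (by linarith))
  · calc ‖(a x + ζ) * ξ 0‖ ≤ (A + t) * ‖ξ‖ := by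
          rw [norm_mul]
          gcongr
          exact norm_add_le_of_le (by simpa using hA x) hζ
      _ ≤ (1 + A + t) * ‖ξ‖ := by gcongr; linarith

lemma exists_isSolution_schrodingerMatrix (ha : Continuous a) (hA : ∀ x, |a x| ≤ A) (ζ : ℂ) (y : ℝ)
    (ξ : Fin 2 → ℂ) : ∃ φ, IsSolution (schrodingerMatrix a ζ) φ ∧ φ y = ξ := by
  refine exists_isSolution ?_ (norm_schrodingerMatrix_mulVec_le hA le_rfl) y ξ
  have hentry : Continuous fun x => (a x : ℂ) + ζ := by fun_prop
  exact continuous_matrix <| Fin.forall_fin_two.2 ⟨Fin.forall_fin_two.2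
    ⟨continuous_const, continuous_const⟩, Fin.forall_fin_two.2 ⟨hentry, continuous_const⟩⟩

namespace IsSolution

lemma hasDerivAt_zero (hφ : IsSolution (schrodingerMatrix a ζ) φ) (x : ℝ) :
    HasDerivAt (fun x => φ x 0) (φ x 1) x :=
  (isSolution_schrodingerMatrix_iff.1 hφ).1 x

lemma hasDerivAt_one (hφ : IsSolution (schrodingerMatrix a ζ) φ) (x : ℝ) :
    HasDerivAt (fun x => φ x 1) ((a x + ζ) * φ x 0) x :=
  (isSolution_schrodingerMatrix_iff.1 hφ).2 x

lemma star (hφ : IsSolution (schrodingerMatrix a ζ) φ) :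
    IsSolution (schrodingerMatrix a (conj ζ)) (star φ) :=
  isSolution_schrodingerMatrix_iff.2 ⟨fun x => (hφ.hasDerivAt_zero x).star, fun x =>
    (hφ.hasDerivAt_one x).star.congr_deriv (by simp)⟩

lemma hasDerivAt_wronskian (h₁ : IsSolution (schrodingerMatrix a ζ₁) φ₁)
    (h₂ : IsSolution (schrodingerMatrix a ζ₂) φ₂) (x : ℝ) :
    HasDerivAt (fun x => wronskian (φ₁ x) (φ₂ x)) ((ζ₂ - ζ₁) * (φ₁ x 0 * φ₂ x 0)) x :=
  (((h₁.hasDerivAt_zero x).mul (h₂.hasDerivAt_one x)).sub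
    ((h₁.hasDerivAt_one x).mul (h₂.hasDerivAt_zero x))).congr_deriv (by ring)

lemma wronskian_eq (h₁ : IsSolution (schrodingerMatrix a ζ) φ₁)
    (h₂ : IsSolution (schrodingerMatrix a ζ) φ₂) (x y : ℝ) :
    wronskian (φ₁ x) (φ₂ x) = wronskian (φ₁ y) (φ₂ y) :=
  is_const_of_deriv_eq_zero (fun z => (h₁.hasDerivAt_wronskian h₂ z).differentiableAt)
    (fun z => by rw [(h₁.hasDerivAt_wronskian h₂ z).deriv, sub_self, zero_mul]) x y

lemma exists_eq_smul_of_wronskian_eq_zero (hA : ∀ x, |a x| ≤ A)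
    (h₁ : IsSolution (schrodingerMatrix a ζ) φ₁) (h₂ : IsSolution (schrodingerMatrix a ζ) φ₂)
    (hne : φ₁ ≠ 0) {y : ℝ} (hw : wronskian (φ₁ y) (φ₂ y) = 0) : ∃ k : ℂ, φ₂ = k • φ₁ := by
  obtain ⟨k, hk⟩ := FastEvans.exists_eq_smul_of_wronskian_eq_zero
    (fun h => hne (h₁.eq_zero_of_apply_eq_zero (norm_schrodingerMatrix_mulVec_le hA le_rfl) h)) hw
  exact ⟨k, h₂.eq_of_apply_eq (h₁.const_smul k) (norm_schrodingerMatrix_mulVec_le hA le_rfl) hk⟩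

end IsSolution

/-- The image of `φ` under the reflection `x ↦ -x`, which reverses the sign of `q = v'`. -/
def reflect (φ : ℝ → Fin 2 → ℂ) (x : ℝ) : Fin 2 → ℂ := ![φ (-x) 0, -φ (-x) 1]

lemma reflect_reflect (φ : ℝ → Fin 2 → ℂ) : reflect (reflect φ) = φ := by
  ext x i
  fin_cases i <;> simp [reflect]

lemma norm_reflect (φ : ℝ → Fin 2 → ℂ) (x : ℝ) : ‖reflect φ x‖ = ‖φ (-x)‖ := by
  simp [reflect, Pi.norm_def, Fin.univ_succ]

lemma wronskian_reflect (φ ψ : ℝ → Fin 2 → ℂ) (x : ℝ) :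
    wronskian (reflect φ x) (reflect ψ x) = -wronskian (φ (-x)) (ψ (-x)) := by
  simp only [wronskian, reflect, cons_val_zero, cons_val_one]; ring

lemma IsSolution.reflect (hφ : IsSolution (schrodingerMatrix a ζ) φ) :
    IsSolution (schrodingerMatrix (fun x => a (-x)) ζ) (reflect φ) :=
  isSolution_schrodingerMatrix_iff.2
    ⟨fun x => ((hφ.hasDerivAt_zero (-x)).scomp x (hasDerivAt_neg x)).congr_deriv
      (by simp [FastEvans.reflect]),
    fun x => ((hφ.hasDerivAt_one (-x)).scomp x (hasDerivAt_neg x)).neg.congr_deriv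
      (by simp [FastEvans.reflect])⟩

lemma IsBoundedOn.reflect {J : Set ℝ} (hφ : IsBoundedOn φ J) : IsBoundedOn (reflect φ) (-J) :=
  hφ.imp fun _ hC x hx => (norm_reflect φ x).trans_le (hC (-x) hx)

end Schrodinger

section Lyapunov

/-- A continuous potential `a` with `|a| ≤ A` such that `a + Λ` is at least `c ∈ (0, 1]` outside
`(-R, R)`. -/
structure IsCoercivePotential (a : ℝ → ℝ) (Λ A c R : ℝ) : Prop where
  continuous : Continuous a
  abs_le : ∀ x, |a x| ≤ A
  pos : 0 < c
  le_one : c ≤ 1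
  nonneg : 0 ≤ R
  le_add : ∀ x, R ≤ |x| → c ≤ a x + Λ

/-- `Re (conj v * q)` for `ξ = (v, q)`. Along solutions it is half of the derivative of `|v|²`, and
it serves as a Lyapunov function where the potential is coercive. -/
def lyap (ξ : Fin 2 → ℂ) : ℝ := inner ℝ (ξ 0) (ξ 1)

/-- The constant `κ` in the estimate `κ ‖φ x‖² ≤ lyap (φ (x + 1)) - lyap (φ x)`, valid for the
spectral parameters `‖ζ‖ ≤ t`. -/
def lyapConst (A c t : ℝ) : ℝ := c * Real.exp (-(2 * (1 + A + t)))

variable {a : ℝ → ℝ} {Λ A c R t : ℝ} {ζ : ℂ} {φ : ℝ → Fin 2 → ℂ}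

lemma abs_lyap_le (ξ : Fin 2 → ℂ) : |lyap ξ| ≤ ‖ξ 0‖ * ‖ξ 1‖ := abs_real_inner_le_norm _ _

lemma abs_lyap_le_norm_sq (ξ : Fin 2 → ℂ) : |lyap ξ| ≤ ‖ξ‖ ^ 2 :=
  (abs_lyap_le ξ).trans (by rw [sq]; gcongr <;> exact norm_le_pi_norm ξ _)

@[fun_prop]
lemma continuous_lyap : Continuous lyap := by unfold lyap; fun_prop

lemma lyap_eq_zero_of_apply_zero {ξ : Fin 2 → ℂ} (h : ξ 0 = 0) : lyap ξ = 0 := by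
  rw [lyap, h, inner_zero_left]

lemma apply_zero_ne_zero_of_lyap_ne_zero {ξ : Fin 2 → ℂ} (h : lyap ξ ≠ 0) : ξ 0 ≠ 0 :=
  mt lyap_eq_zero_of_apply_zero h

lemma lyapConst_pos (hc : 0 < c) : 0 < lyapConst A c t := mul_pos hc (Real.exp_pos _)

namespace IsCoercivePotential

lemma comp_neg (hP : IsCoercivePotential a Λ A c R) :
    IsCoercivePotential (fun x => a (-x)) Λ A c R where
  continuous := hP.continuous.comp continuous_neg
  abs_le x := hP.abs_le (-x)
  pos := hP.pos
  le_one := hP.le_one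
  nonneg := hP.nonneg
  le_add x hx := hP.le_add (-x) (by rwa [abs_neg])

lemma mul_norm_sq_le (hP : IsCoercivePotential a Λ A c R) (hζ : ζ ∈ halfPlane Λ) {x : ℝ}
    (hx : R ≤ x) (ξ : Fin 2 → ℂ) :
    c * ‖ξ‖ ^ 2 ≤ ‖ξ 1‖ ^ 2 + (a x + ζ.re) * ‖ξ 0‖ ^ 2 := by
  have hc := hP.pos
  have hnorm : ‖ξ‖ ^ 2 ≤ ‖ξ 1‖ ^ 2 + ‖ξ 0‖ ^ 2 := by
    refine (Real.le_sqrt (norm_nonneg ξ) (by positivity)).1 ?_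
    rw [pi_norm_le_iff_of_nonneg (Real.sqrt_nonneg _), Fin.forall_fin_two]
    constructor <;> refine Real.le_sqrt_of_sq_le ?_ <;> simp
  have hcoer : c ≤ a x + ζ.re :=
    (hP.le_add x (hx.trans (le_abs_self x))).trans (by gcongr; exact le_of_lt hζ)
  calc c * ‖ξ‖ ^ 2 ≤ c * ‖ξ 1‖ ^ 2 + c * ‖ξ 0‖ ^ 2 := by rw [← mul_add]; gcongr
    _ ≤ ‖ξ 1‖ ^ 2 + (a x + ζ.re) * ‖ξ 0‖ ^ 2 := by
      gcongr
      exact mul_le_of_le_one_left (by positivity) hP.le_one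

end IsCoercivePotential

namespace IsSolution

lemma hasDerivAt_lyap (hφ : IsSolution (schrodingerMatrix a ζ) φ) (x : ℝ) :
    HasDerivAt (fun x => lyap (φ x)) (‖φ x 1‖ ^ 2 + (a x + ζ.re) * ‖φ x 0‖ ^ 2) x :=
  ((hφ.hasDerivAt_zero x).inner ℝ (hφ.hasDerivAt_one x)).congr_deriv <| by
    simp only [Complex.inner, ← Complex.normSq_eq_norm_sq, Complex.normSq_apply, Complex.mul_re,
      Complex.mul_im, Complex.add_re, Complex.add_im, Complex.conj_re, Complex.conj_im,
      Complex.ofReal_re, Complex.ofReal_im]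
    ring

lemma monotoneOn_exp_mul_lyap (hφ : IsSolution (schrodingerMatrix a ζ) φ)
    (hP : IsCoercivePotential a Λ A c R) (hζ : ζ ∈ halfPlane Λ) {s : ℝ} (hs : |s| ≤ c) :
    MonotoneOn (fun x => Real.exp (s * x) * lyap (φ x)) (Ici R) := by
  have hd : ∀ x, HasDerivAt (fun x => Real.exp (s * x) * lyap (φ x)) (Real.exp (s * x) *
      (s * lyap (φ x) + (‖φ x 1‖ ^ 2 + (a x + ζ.re) * ‖φ x 0‖ ^ 2))) x := fun x =>
    (((hasDerivAt_id x).const_mul s).exp.mul (hφ.hasDerivAt_lyap x)).congr_deriv (by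
      simp only [id, mul_one]; ring)
  refine monotoneOn_of_deriv_nonneg (convex_Ici R)
    (fun x _ => (hd x).continuousAt.continuousWithinAt)
    (fun x _ => (hd x).differentiableAt.differentiableWithinAt) fun x hx => ?_
  rw [interior_Ici] at hx
  have hlyap : -(c * ‖φ x‖ ^ 2) ≤ s * lyap (φ x) := neg_le_of_abs_le <|
    (abs_mul _ _).trans_le (mul_le_mul hs (abs_lyap_le_norm_sq _) (abs_nonneg _) hP.pos.le)
  have hcoer := hP.mul_norm_sq_le hζ (le_of_lt hx) (φ x)
  rw [(hd x).deriv]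
  exact mul_nonneg (Real.exp_pos _).le (by linarith)

lemma monotoneOn_lyap (hφ : IsSolution (schrodingerMatrix a ζ) φ)
    (hP : IsCoercivePotential a Λ A c R) (hζ : ζ ∈ halfPlane Λ) :
    MonotoneOn (fun x => lyap (φ x)) (Ici R) := by
  simpa using hφ.monotoneOn_exp_mul_lyap hP hζ (s := 0) (by simpa using hP.pos.le)

lemma lyapConst_mul_le (hφ : IsSolution (schrodingerMatrix a ζ) φ)
    (hP : IsCoercivePotential a Λ A c R) (hζ : ζ ∈ halfPlane Λ) (ht : ‖ζ‖ ≤ t) {x z : ℝ}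
    (hx : R ≤ x) (hz : z ∈ Icc x (x + 1)) :
    lyapConst A c t * ‖φ z‖ ^ 2 ≤ lyap (φ (x + 1)) - lyap (φ x) := by
  obtain ⟨y, hy, hslope⟩ := exists_hasDerivAt_eq_slope (fun x => lyap (φ x)) _ (lt_add_one x)
    (fun y _ => (hφ.hasDerivAt_lyap y).continuousAt.continuousWithinAt)
    fun y _ => hφ.hasDerivAt_lyap y
  rw [add_sub_cancel_left, div_one] at hslope
  have hM : 0 ≤ 1 + A + t := by
    linarith [(abs_nonneg _).trans (hP.abs_le 0), (norm_nonneg ζ).trans ht]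
  have hyz : |z - y| ≤ 1 := abs_le.2 ⟨by linarith [hz.1, hy.2], by linarith [hz.2, hy.1]⟩
  have hgrowth : ‖φ z‖ ≤ Real.exp (1 + A + t) * ‖φ y‖ :=
    (hφ.norm_le_exp (norm_schrodingerMatrix_mulVec_le hP.abs_le ht) z y).trans <| by
      gcongr
      exact mul_le_of_le_one_right hM hyz
  have hc := hP.pos
  calc lyapConst A c t * ‖φ z‖ ^ 2
      ≤ lyapConst A c t * (Real.exp (1 + A + t) * ‖φ y‖) ^ 2 := by
        have := (lyapConst_pos (A := A) (t := t) hc).le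
        gcongr
    _ = c * ‖φ y‖ ^ 2 := by
        rw [lyapConst, mul_pow, ← Real.exp_nat_mul, Nat.cast_ofNat, mul_assoc c,
          ← mul_assoc (Real.exp _), ← Real.exp_add]
        simp
    _ ≤ lyap (φ (x + 1)) - lyap (φ x) := by
        rw [← hslope]
        exact hP.mul_norm_sq_le hζ (hx.trans hy.1.le) (φ y)

lemma lyap_nonpos (hφ : IsSolution (schrodingerMatrix a ζ) φ)
    (hP : IsCoercivePotential a Λ A c R) (hζ : ζ ∈ halfPlane Λ) (hb : IsBoundedOn φ (Ici 0))
    {x : ℝ} (hx : R ≤ x) : lyap (φ x) ≤ 0 := by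
  obtain ⟨C, hC⟩ := hb
  have hc := hP.pos
  by_contra! hpos
  have hlim : Tendsto (fun y => Real.exp (c * y) * (Real.exp (-c * x) * lyap (φ x))) atTop atTop :=
    (Real.tendsto_exp_atTop.comp (tendsto_id.const_mul_atTop hc)).atTop_mul_const (by positivity)
  obtain ⟨y, hCy, hxy⟩ := ((hlim.eventually_gt_atTop (C ^ 2)).and (eventually_ge_atTop x)).exists
  have hy : R ≤ y := hx.trans hxy
  have hmono := hφ.monotoneOn_exp_mul_lyap hP hζ (s := -c) (by simp [abs_of_pos hc]) hx hy hxy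
  have hle : Real.exp (c * y) * (Real.exp (-c * x) * lyap (φ x)) ≤ C ^ 2 :=
    calc _ ≤ Real.exp (c * y) * (Real.exp (-c * y) * lyap (φ y)) := by gcongr
      _ = lyap (φ y) := by rw [← mul_assoc, ← Real.exp_add]; simp
      _ ≤ ‖φ y‖ ^ 2 := (le_abs_self _).trans (abs_lyap_le_norm_sq _)
      _ ≤ C ^ 2 := by gcongr; exact hC y (hP.nonneg.trans hy)
  exact hCy.not_ge hle

lemma lyapConst_mul_le_neg_lyap (hφ : IsSolution (schrodingerMatrix a ζ) φ)
    (hP : IsCoercivePotential a Λ A c R) (hζ : ζ ∈ halfPlane Λ) (ht : ‖ζ‖ ≤ t) {x : ℝ}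
    (hx : R ≤ x) (hL : lyap (φ (x + 1)) ≤ 0) : lyapConst A c t * ‖φ x‖ ^ 2 ≤ -lyap (φ x) :=
  (hφ.lyapConst_mul_le hP hζ ht hx (left_mem_Icc.2 (by simp))).trans (by linarith)

lemma lyapConst_mul_le_lyap (hφ : IsSolution (schrodingerMatrix a ζ) φ)
    (hP : IsCoercivePotential a Λ A c R) (hζ : ζ ∈ halfPlane Λ) (ht : ‖ζ‖ ≤ t)
    (hL : 0 ≤ lyap (φ R)) {x : ℝ} (hx : R + 1 ≤ x) :
    lyapConst A c t * ‖φ x‖ ^ 2 ≤ lyap (φ x) := by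
  have hx' : R ≤ x - 1 := by linarith
  have hmono : lyap (φ R) ≤ lyap (φ (x - 1)) := hφ.monotoneOn_lyap hP hζ self_mem_Ici hx' hx'
  have h := hφ.lyapConst_mul_le hP hζ ht hx' (z := x) ⟨by simp, by simp⟩
  rw [sub_add_cancel] at h
  linarith

lemma lyapConst_mul_norm_sq_le_exp (hφ : IsSolution (schrodingerMatrix a ζ) φ)
    (hP : IsCoercivePotential a Λ A c R) (hζ : ζ ∈ halfPlane Λ) (ht : ‖ζ‖ ≤ t)
    (hL : ∀ x, R ≤ x → lyap (φ x) ≤ 0) {x y : ℝ} (hy : R ≤ y) (hyx : y ≤ x) :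
    lyapConst A c t * ‖φ x‖ ^ 2 ≤ Real.exp (-c * (x - y)) * ‖φ y‖ ^ 2 := by
  have hx : R ≤ x := hy.trans hyx
  have hmono := hφ.monotoneOn_exp_mul_lyap hP hζ (s := c) (by simp [abs_of_pos hP.pos]) hy hx hyx
  calc lyapConst A c t * ‖φ x‖ ^ 2 ≤ -lyap (φ x) :=
        hφ.lyapConst_mul_le_neg_lyap hP hζ ht hx (hL _ (by linarith))
    _ = Real.exp (-c * x) * -(Real.exp (c * x) * lyap (φ x)) := by
        rw [mul_neg, ← mul_assoc, ← Real.exp_add]; simp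
    _ ≤ Real.exp (-c * x) * -(Real.exp (c * y) * lyap (φ y)) := by gcongr
    _ = Real.exp (-c * (x - y)) * -lyap (φ y) := by
        rw [mul_neg, mul_neg, ← mul_assoc, ← Real.exp_add]; ring_nf
    _ ≤ Real.exp (-c * (x - y)) * ‖φ y‖ ^ 2 := by
        gcongr
        exact (neg_le_abs _).trans (abs_lyap_le_norm_sq _)

lemma sqrt_lyapConst_mul_norm_le_exp (hφ : IsSolution (schrodingerMatrix a ζ) φ)
    (hP : IsCoercivePotential a Λ A c R) (hζ : ζ ∈ halfPlane Λ) (ht : ‖ζ‖ ≤ t)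
    (hL : ∀ x, R ≤ x → lyap (φ x) ≤ 0) {x y : ℝ} (hy : R ≤ y) (hyx : y ≤ x) :
    √(lyapConst A c t) * ‖φ x‖ ≤ Real.exp (-(c / 2) * (x - y)) * ‖φ y‖ := by
  refine le_of_sq_le_sq ?_ (by positivity)
  rw [mul_pow, mul_pow, Real.sq_sqrt (lyapConst_pos hP.pos).le, ← Real.exp_nat_mul,
    Nat.cast_ofNat, ← mul_assoc 2, show 2 * -(c / 2) = -c by ring]
  exact hφ.lyapConst_mul_norm_sq_le_exp hP hζ ht hL hy hyx

lemma isBoundedOn_of_lyap_nonpos (hφ : IsSolution (schrodingerMatrix a ζ) φ)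
    (hP : IsCoercivePotential a Λ A c R) (hζ : ζ ∈ halfPlane Λ)
    (hL : ∀ x, R ≤ x → lyap (φ x) ≤ 0) : IsBoundedOn φ (Ici 0) := by
  have hκ : 0 < √(lyapConst A c ‖ζ‖) := Real.sqrt_pos.2 (lyapConst_pos hP.pos)
  obtain ⟨C, hC⟩ := (isCompact_Icc (a := 0) (b := R)).exists_bound_of_continuousOn
    hφ.continuous.continuousOn
  refine ⟨max C (‖φ R‖ / √(lyapConst A c ‖ζ‖)), fun x hx => ?_⟩
  rcases le_total x R with hxR | hRx
  · exact (hC x ⟨hx, hxR⟩).trans (le_max_left _ _)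
  · refine ((le_div_iff₀' hκ).2 ?_).trans (le_max_right _ _)
    refine (hφ.sqrt_lyapConst_mul_norm_le_exp hP hζ le_rfl hL le_rfl hRx).trans ?_
    exact mul_le_of_le_one_left (norm_nonneg _) (Real.exp_le_one_iff.2 (by nlinarith [hP.pos]))

lemma lyap_neg (hφ : IsSolution (schrodingerMatrix a ζ) φ)
    (hP : IsCoercivePotential a Λ A c R) (hζ : ζ ∈ halfPlane Λ) (hb : IsBoundedOn φ (Ici 0))
    (hne : φ ≠ 0) {x : ℝ} (hx : R ≤ x) : lyap (φ x) < 0 := by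
  have hpos : 0 < lyapConst A c ‖ζ‖ * ‖φ x‖ ^ 2 :=
    mul_pos (lyapConst_pos hP.pos) (pow_pos (norm_pos_iff.2 fun h0 => hne
      (hφ.eq_zero_of_apply_eq_zero (norm_schrodingerMatrix_mulVec_le hP.abs_le le_rfl) h0)) 2)
  exact neg_pos.1 (hpos.trans_le
    (hφ.lyapConst_mul_le_neg_lyap hP hζ le_rfl hx (hφ.lyap_nonpos hP hζ hb (by linarith))))

lemma apply_zero_ne_zero (hφ : IsSolution (schrodingerMatrix a ζ) φ)
    (hP : IsCoercivePotential a Λ A c R) (hζ : ζ ∈ halfPlane Λ) (hb : IsBoundedOn φ (Ici 0))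
    (hne : φ ≠ 0) {x : ℝ} (hx : R ≤ x) : φ x 0 ≠ 0 :=
  apply_zero_ne_zero_of_lyap_ne_zero (hφ.lyap_neg hP hζ hb hne hx).ne

lemma isBigO_exp_atTop (hφ : IsSolution (schrodingerMatrix a ζ) φ)
    (hP : IsCoercivePotential a Λ A c R) (hζ : ζ ∈ halfPlane Λ) (hb : IsBoundedOn φ (Ici 0)) :
    φ =O[atTop] fun x => Real.exp (-(c / 2) * x) := by
  have hκ : 0 < √(lyapConst A c ‖ζ‖) := Real.sqrt_pos.2 (lyapConst_pos hP.pos)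
  refine Asymptotics.IsBigO.of_bound (Real.exp (c / 2 * R) * ‖φ R‖ / √(lyapConst A c ‖ζ‖)) ?_
  filter_upwards [eventually_ge_atTop R] with x hx
  rw [Real.norm_of_nonneg (Real.exp_pos _).le, div_mul_eq_mul_div, le_div_iff₀' hκ]
  calc √(lyapConst A c ‖ζ‖) * ‖φ x‖ ≤ Real.exp (-(c / 2) * (x - R)) * ‖φ R‖ :=
        hφ.sqrt_lyapConst_mul_norm_le_exp hP hζ le_rfl (fun z hz => hφ.lyap_nonpos hP hζ hb hz)
          le_rfl hx
    _ = Real.exp (c / 2 * R) * ‖φ R‖ * Real.exp (-(c / 2) * x) := by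
        rw [mul_right_comm, ← Real.exp_add]
        ring_nf

lemma tendsto_atTop (hφ : IsSolution (schrodingerMatrix a ζ) φ)
    (hP : IsCoercivePotential a Λ A c R) (hζ : ζ ∈ halfPlane Λ) (hb : IsBoundedOn φ (Ici 0)) :
    Tendsto φ atTop (𝓝 0) :=
  (hφ.isBigO_exp_atTop hP hζ hb).trans_tendsto (Real.tendsto_exp_atBot.comp
    (tendsto_id.const_mul_atTop_of_neg (by linarith [hP.pos])))

end IsSolution

end Lyapunov

section BoundedSolutions

variable {a : ℝ → ℝ} {Λ A c R t : ℝ} {ζ : ℂ} {φ φ₁ φ₂ : ℝ → Fin 2 → ℂ}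

namespace IsSolution

lemma norm_le_inv_lyapConst (hφ : IsSolution (schrodingerMatrix a ζ) φ)
    (hP : IsCoercivePotential a Λ A c R) (hζ : ζ ∈ halfPlane Λ) (ht : ‖ζ‖ ≤ t)
    (hL : lyap (φ (R + 1)) ≤ 0) (h1 : φ R 0 = 1) : ‖φ R‖ ≤ (lyapConst A c t)⁻¹ := by
  have hκ : 0 < lyapConst A c t := lyapConst_pos hP.pos
  have hpos : 0 < ‖φ R‖ := norm_pos_iff.2 fun h => by simp [h] at h1
  have hle : lyapConst A c t * ‖φ R‖ ^ 2 ≤ ‖φ R‖ :=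
    calc lyapConst A c t * ‖φ R‖ ^ 2 ≤ -lyap (φ R) :=
          hφ.lyapConst_mul_le_neg_lyap hP hζ ht le_rfl hL
      _ ≤ ‖φ R 0‖ * ‖φ R 1‖ := (neg_le_abs _).trans (abs_lyap_le _)
      _ ≤ ‖φ R‖ := by simpa [h1] using norm_le_pi_norm (φ R) 1
  rw [le_inv_comm₀ hpos hκ, ← one_div, le_div_iff₀ hpos]
  nlinarith

end IsSolution

/-- Shooting: for each `n` some combination of two fundamental solutions has `lyap ≤ 0` at
`R + 1 + n`. These parameter sets are compact and nested, since `lyap` increases. -/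
theorem exists_isSolution_isBoundedOn_Ici (hP : IsCoercivePotential a Λ A c R)
    (hζ : ζ ∈ halfPlane Λ) : ∃ φ, IsSolution (schrodingerMatrix a ζ) φ ∧
      IsBoundedOn φ (Ici 0) ∧ φ R 0 = 1 := by
  have hκ : 0 < lyapConst A c ‖ζ‖ := lyapConst_pos hP.pos
  obtain ⟨φ₁, h₁, hR₁⟩ := exists_isSolution_schrodingerMatrix hP.continuous hP.abs_le ζ R ![1, 0]
  obtain ⟨φ₂, h₂, hR₂⟩ := exists_isSolution_schrodingerMatrix hP.continuous hP.abs_le ζ R ![0, 1]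
  let ψ (k : ℂ) := φ₁ + k • φ₂
  have hψ : ∀ k, IsSolution (schrodingerMatrix a ζ) (ψ k) := fun k => h₁.add (h₂.const_smul k)
  have hψR : ∀ k, ψ k R = ![1, k] := fun k => by simp [ψ, hR₁, hR₂]
  have hmono := fun k => (hψ k).monotoneOn_lyap hP hζ
  let S (n : ℕ) : Set ℂ := {k | lyap (ψ k (R + 1 + n)) ≤ 0}
  have hS : ∀ n, IsClosed (S n) := fun n => isClosed_le
    (continuous_lyap.comp (by unfold ψ; fun_prop : Continuous fun k => ψ k (R + 1 + n)))
    continuous_const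
  have hS0 : IsCompact (S 0) := (isCompact_closedBall 0 (lyapConst A c ‖ζ‖)⁻¹).of_isClosed_subset
    (hS 0) fun k hk => by
      have hle := (hψ k).norm_le_inv_lyapConst hP hζ le_rfl (by simpa [S] using hk) (by simp [hψR])
      simpa [hψR] using (norm_le_pi_norm (ψ k R) 1).trans hle
  have hnested : ∀ n, S (n + 1) ⊆ S n := fun n k hk =>
    (hmono k (mem_Ici.2 (by linarith [n.cast_nonneg (α := ℝ)]))
      (mem_Ici.2 (by linarith [(n + 1).cast_nonneg (α := ℝ)]))
      (by push_cast; linarith)).trans hk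
  have hnonempty : ∀ n, (S n).Nonempty := fun n => by
    have hne : φ₂ (R + 1 + n) 0 ≠ 0 := apply_zero_ne_zero_of_lyap_ne_zero (ne_of_gt <|
      (mul_pos hκ (pow_pos (norm_pos_iff.2 fun h0 => ?_) 2)).trans_le
        (h₂.lyapConst_mul_le_lyap hP hζ le_rfl (by simp [lyap, hR₂]) (by simp)))
    · exact ⟨-φ₁ (R + 1 + n) 0 / φ₂ (R + 1 + n) 0,
        (lyap_eq_zero_of_apply_zero (by simp [ψ, hne])).le⟩
    · have := h₂.eq_zero_of_apply_eq_zero (norm_schrodingerMatrix_mulVec_le hP.abs_le le_rfl) h0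
      simpa [this] using congrFun hR₂ 1
  obtain ⟨k, hk⟩ :=
    IsCompact.nonempty_iInter_of_sequence_nonempty_isCompact_isClosed S hnested hnonempty hS0 hS
  refine ⟨ψ k, hψ k, (hψ k).isBoundedOn_of_lyap_nonpos hP hζ fun x hx => ?_, by simp [hψR]⟩
  obtain ⟨n, hn⟩ := exists_nat_ge x
  exact (hmono k hx (mem_Ici.2 (by linarith [n.cast_nonneg (α := ℝ)]))
    (by linarith [hP.nonneg])).trans (mem_iInter.1 hk n)

lemma tendsto_wronskian {l : Filter ℝ} (h₁ : Tendsto φ₁ l (𝓝 0)) (h₂ : Tendsto φ₂ l (𝓝 0)) :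
    Tendsto (fun x => wronskian (φ₁ x) (φ₂ x)) l (𝓝 0) := by
  rw [tendsto_pi_nhds] at h₁ h₂
  simpa [wronskian] using ((h₁ 0).mul (h₂ 1)).sub ((h₁ 1).mul (h₂ 0))

lemma IsSolution.wronskian_eq_zero (h₁ : IsSolution (schrodingerMatrix a ζ) φ₁)
    (h₂ : IsSolution (schrodingerMatrix a ζ) φ₂) (hP : IsCoercivePotential a Λ A c R)
    (hζ : ζ ∈ halfPlane Λ) (hb₁ : IsBoundedOn φ₁ (Ici 0)) (hb₂ : IsBoundedOn φ₂ (Ici 0)) (x : ℝ) :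
    wronskian (φ₁ x) (φ₂ x) = 0 :=
  tendsto_nhds_unique (tendsto_const_nhds.congr fun y => h₁.wronskian_eq h₂ x y)
    (tendsto_wronskian (h₁.tendsto_atTop hP hζ hb₁) (h₂.tendsto_atTop hP hζ hb₂))

end BoundedSolutions

section Dichotomy

variable {a : ℝ → ℝ} {Λ A c R κ : ℝ} {ζ : ℂ} {φ₁ φ₂ : ℝ → Fin 2 → ℂ} {ξ η : Fin 2 → ℂ}

/-- The identity behind the estimate is
`‖ξ 0‖² lyap η - ‖η 0‖² lyap ξ = Re (conj (ξ 0) * conj (η 0) * wronskian ξ η)`. -/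
lemma norm_mul_norm_le_norm_wronskian (hκ : 0 < κ) (hξ : κ * ‖ξ‖ ^ 2 ≤ -lyap ξ)
    (hη : κ * ‖η‖ ^ 2 ≤ lyap η) : 2 * κ * (‖ξ‖ * ‖η‖) ≤ ‖wronskian ξ η‖ := by
  by_cases hξ0 : ξ = 0
  · simp [hξ0]
  by_cases hη0 : η = 0
  · simp [hη0]
  have hξ' : 0 < ‖ξ 0‖ := norm_pos_iff.2 <| apply_zero_ne_zero_of_lyap_ne_zero <| by
    have : 0 < κ * ‖ξ‖ ^ 2 := by positivity
    linarith
  have hη' : 0 < ‖η 0‖ := norm_pos_iff.2 <| apply_zero_ne_zero_of_lyap_ne_zero <| by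
    have : 0 < κ * ‖η‖ ^ 2 := by positivity
    linarith
  have hre : ‖ξ 0‖ ^ 2 * lyap η + ‖η 0‖ ^ 2 * -lyap ξ ≤ ‖ξ 0‖ * ‖η 0‖ * ‖wronskian ξ η‖ :=
    calc ‖ξ 0‖ ^ 2 * lyap η + ‖η 0‖ ^ 2 * -lyap ξ
        = (conj (ξ 0) * conj (η 0) * wronskian ξ η).re := by
          simp only [lyap, wronskian, Complex.inner, ← Complex.normSq_eq_norm_sq,
            Complex.normSq_apply, Complex.mul_re, Complex.mul_im, Complex.sub_re, Complex.sub_im,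
            Complex.conj_re, Complex.conj_im]
          ring
      _ ≤ ‖ξ 0‖ * ‖η 0‖ * ‖wronskian ξ η‖ := by
          simpa using Complex.re_le_norm (conj (ξ 0) * conj (η 0) * wronskian ξ η)
  refine le_of_mul_le_mul_left ?_ (mul_pos hξ' hη')
  calc ‖ξ 0‖ * ‖η 0‖ * (2 * κ * (‖ξ‖ * ‖η‖))
      = κ * (2 * (‖ξ 0‖ * ‖η‖) * (‖η 0‖ * ‖ξ‖)) := by ring
    _ ≤ κ * ((‖ξ 0‖ * ‖η‖) ^ 2 + (‖η 0‖ * ‖ξ‖) ^ 2) := by gcongr; exact two_mul_le_add_sq _ _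
    _ = ‖ξ 0‖ ^ 2 * (κ * ‖η‖ ^ 2) + ‖η 0‖ ^ 2 * (κ * ‖ξ‖ ^ 2) := by ring
    _ ≤ ‖ξ 0‖ ^ 2 * lyap η + ‖η 0‖ ^ 2 * -lyap ξ := by gcongr
    _ ≤ ‖ξ 0‖ * ‖η 0‖ * ‖wronskian ξ η‖ := hre

lemma IsSolution.norm_mul_norm_le_exp (h₁ : IsSolution (schrodingerMatrix a ζ) φ₁)
    (h₂ : IsSolution (schrodingerMatrix a ζ) φ₂) (hP : IsCoercivePotential a Λ A c R)
    (hζ : ζ ∈ halfPlane Λ) (hw : ∀ x, wronskian (φ₁ x) (φ₂ x) = 1)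
    (hL₁ : ∀ x, R ≤ x → lyap (φ₁ x) ≤ 0) (hL₂ : 0 ≤ lyap (φ₂ R)) {x y : ℝ} (hy : R + 1 ≤ y)
    (hyx : y ≤ x) :
    ‖φ₁ x‖ * ‖φ₂ y‖ ≤ (√(lyapConst A c ‖ζ‖) * (2 * lyapConst A c ‖ζ‖))⁻¹ *
      Real.exp (-(c / 2) * (x - y)) := by
  set κ := lyapConst A c ‖ζ‖
  have hκ : 0 < κ := lyapConst_pos hP.pos
  have hRy : R ≤ y := by linarith
  have hprod : 2 * κ * (‖φ₁ y‖ * ‖φ₂ y‖) ≤ 1 := by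
    simpa [hw] using norm_mul_norm_le_norm_wronskian hκ
      (h₁.lyapConst_mul_le_neg_lyap hP hζ le_rfl hRy (hL₁ _ (by linarith)))
      (h₂.lyapConst_mul_le_lyap hP hζ le_rfl hL₂ hy)
  have hdecay : √κ * ‖φ₁ x‖ ≤ Real.exp (-(c / 2) * (x - y)) * ‖φ₁ y‖ :=
    h₁.sqrt_lyapConst_mul_norm_le_exp hP hζ le_rfl hL₁ hRy hyx
  rw [← div_eq_inv_mul, le_div_iff₀ (by positivity)]
  calc ‖φ₁ x‖ * ‖φ₂ y‖ * (√κ * (2 * κ)) = √κ * ‖φ₁ x‖ * (2 * κ * ‖φ₂ y‖) := by ring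
    _ ≤ Real.exp (-(c / 2) * (x - y)) * ‖φ₁ y‖ * (2 * κ * ‖φ₂ y‖) := by gcongr
    _ = Real.exp (-(c / 2) * (x - y)) * (2 * κ * (‖φ₁ y‖ * ‖φ₂ y‖)) := by ring
    _ ≤ Real.exp (-(c / 2) * (x - y)) := mul_le_of_le_one_right (Real.exp_pos _).le hprod

lemma IsSolution.norm_le_exp_mul_norm_max {ι : Type*} [Fintype ι] {B : ℝ → Matrix ι ι ℂ}
    {φ : ℝ → ι → ℂ} {M : ℝ} (hφ : IsSolution B φ) (hM : ∀ x ξ, ‖B x *ᵥ ξ‖ ≤ M * ‖ξ‖)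
    (hM0 : 0 ≤ M) {r x : ℝ} (hr : 0 ≤ r) (hx : 0 ≤ x) :
    ‖φ x‖ ≤ Real.exp (M * r) * ‖φ (max x r)‖ := by
  refine (hφ.norm_le_exp hM x (max x r)).trans ?_
  gcongr
  rw [abs_sub_comm, abs_of_nonneg (sub_nonneg.2 (le_max_left _ _)), sub_le_iff_le_add]
  exact max_le (by linarith) (by linarith)

lemma exists_wronskian_eq_one_norm_mul_norm_le (hP : IsCoercivePotential a Λ A c R)
    (hζ : ζ ∈ halfPlane Λ) : ∃ (φ₁ φ₂ : ℝ → Fin 2 → ℂ) (K μ : ℝ),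
      IsSolution (schrodingerMatrix a ζ) φ₁ ∧ IsSolution (schrodingerMatrix a ζ) φ₂ ∧
      (∀ x, wronskian (φ₁ x) (φ₂ x) = 1) ∧ 0 < K ∧ 0 < μ ∧
      ∀ x y, 0 ≤ y → y ≤ x → ‖φ₁ x‖ * ‖φ₂ y‖ ≤ K * Real.exp (-μ * (x - y)) := by
  obtain ⟨φ₁, h₁, hb₁, hR₁⟩ := exists_isSolution_isBoundedOn_Ici hP hζ
  obtain ⟨φ₂, h₂, hR₂⟩ := exists_isSolution_schrodingerMatrix hP.continuous hP.abs_le ζ R ![0, 1]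
  have hw : ∀ x, wronskian (φ₁ x) (φ₂ x) = 1 := fun x =>
    (h₁.wronskian_eq h₂ x R).trans (by simp [wronskian, hR₁, hR₂])
  set κ := lyapConst A c ‖ζ‖
  have hκ : 0 < κ := lyapConst_pos hP.pos
  set M := 1 + A + ‖ζ‖
  have hM0 : 0 ≤ M := by linarith [(abs_nonneg _).trans (hP.abs_le 0), norm_nonneg ζ]
  have hM := norm_schrodingerMatrix_mulVec_le hP.abs_le (le_refl ‖ζ‖)
  set r := R + 1
  have hr : 0 ≤ r := by linarith [hP.nonneg]
  have hc := hP.pos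
  refine ⟨φ₁, φ₂, Real.exp (M * r) ^ 2 * (√κ * (2 * κ))⁻¹ * Real.exp (c / 2 * r), c / 2, h₁, h₂, hw,
    by positivity, by positivity, fun x y hy hyx => ?_⟩
  have hdist : x - y - r ≤ max x r - max y r := by
    linarith [le_max_left x r, max_le (by linarith : y ≤ y + r) (by linarith : r ≤ y + r)]
  calc ‖φ₁ x‖ * ‖φ₂ y‖
      ≤ (Real.exp (M * r) * ‖φ₁ (max x r)‖) * (Real.exp (M * r) * ‖φ₂ (max y r)‖) := by
        gcongr
        · exact h₁.norm_le_exp_mul_norm_max hM hM0 hr (hy.trans hyx)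
        · exact h₂.norm_le_exp_mul_norm_max hM hM0 hr hy
    _ = Real.exp (M * r) ^ 2 * (‖φ₁ (max x r)‖ * ‖φ₂ (max y r)‖) := by ring
    _ ≤ Real.exp (M * r) ^ 2 *
          ((√κ * (2 * κ))⁻¹ * Real.exp (-(c / 2) * (max x r - max y r))) := by
        refine mul_le_mul_of_nonneg_left ?_ (by positivity)
        exact h₁.norm_mul_norm_le_exp h₂ hP hζ hw (fun z hz => h₁.lyap_nonpos hP hζ hb₁ hz)
          (by simp [lyap, hR₂]) (le_max_right _ _) (max_le_max_right _ hyx)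
    _ ≤ Real.exp (M * r) ^ 2 *
          ((√κ * (2 * κ))⁻¹ * (Real.exp (c / 2 * r) * Real.exp (-(c / 2) * (x - y)))) := by
        gcongr
        rw [← Real.exp_add]
        gcongr
        nlinarith
    _ = _ := by ring

theorem exists_hasExpDichotomyOn_Ici (hP : IsCoercivePotential a Λ A c R) (hζ : ζ ∈ halfPlane Λ) :
    ∃ K μ P, HasExpDichotomyOn (schrodingerMatrix a ζ) (Ici 0) K μ P := by
  obtain ⟨φ₁, φ₂, K, μ, h₁, h₂, hw, hK, hμ, hle⟩ := exists_wronskian_eq_one_norm_mul_norm_le hP hζ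
  exact ⟨_, _, _, hasExpDichotomyOn_of_wronskian_eq_one h₁ h₂ hw hK hμ
    fun x _ y hy hyx => hle x y hy hyx⟩

theorem exists_hasExpDichotomyOn_Iic (hP : IsCoercivePotential a Λ A c R) (hζ : ζ ∈ halfPlane Λ) :
    ∃ K μ P, HasExpDichotomyOn (schrodingerMatrix a ζ) (Iic 0) K μ P := by
  obtain ⟨ψ₁, ψ₂, K, μ, h₁, h₂, hw, hK, hμ, hle⟩ :=
    exists_wronskian_eq_one_norm_mul_norm_le hP.comp_neg hζ
  refine ⟨_, _, _, hasExpDichotomyOn_of_wronskian_eq_one (φ₁ := reflect ψ₂) (φ₂ := reflect ψ₁)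
    (by simpa using h₂.reflect) (by simpa using h₁.reflect) (fun x => ?_) hK hμ
    fun x hx y _ hyx => ?_⟩
  · rw [wronskian_reflect, ← wronskian_swap, hw]
  · rw [norm_reflect, norm_reflect, mul_comm]
    simpa [add_comm, sub_eq_add_neg] using
      hle (-y) (-x) (neg_nonneg.2 (mem_Iic.1 hx)) (neg_le_neg hyx)

end Dichotomy

section Analyticity

variable {a : ℝ → ℝ} {Λ A c R : ℝ} {ζ ζ₀ ζ₁ ζ₂ : ℂ} {φ₁ φ₂ χ : ℝ → Fin 2 → ℂ}

namespace IsSolution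

lemma integrableOn_mul (h₁ : IsSolution (schrodingerMatrix a ζ₁) φ₁)
    (h₂ : IsSolution (schrodingerMatrix a ζ₂) φ₂) (hP : IsCoercivePotential a Λ A c R)
    (hζ₁ : ζ₁ ∈ halfPlane Λ) (hζ₂ : ζ₂ ∈ halfPlane Λ) (hb₁ : IsBoundedOn φ₁ (Ici 0))
    (hb₂ : IsBoundedOn φ₂ (Ici 0)) (b : ℝ) :
    IntegrableOn (fun x => φ₁ x 0 * φ₂ x 0) (Ioi b) := by
  have hcont : Continuous fun x => φ₁ x 0 * φ₂ x 0 :=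
    ((continuous_apply 0).comp h₁.continuous).mul ((continuous_apply 0).comp h₂.continuous)
  have hO₁ := (Asymptotics.isBigO_pi.1 (h₁.isBigO_exp_atTop hP hζ₁ hb₁) 0)
  have hO₂ := (Asymptotics.isBigO_pi.1 (h₂.isBigO_exp_atTop hP hζ₂ hb₂) 0)
  have hO : (fun x => φ₁ x 0 * φ₂ x 0) =O[atTop] fun x => Real.exp (-c * x) :=
    (hO₁.mul hO₂).congr_right fun x => by rw [← Real.exp_add]; ring_nf
  exact ((hcont.locallyIntegrable.locallyIntegrableOn _).integrableOn_of_isBigO_atTop hO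
    ⟨Ioi 0, Ioi_mem_atTop 0, exp_neg_integrableOn_Ioi 0 hP.pos⟩).mono_set Ioi_subset_Ici_self

lemma mul_integral_Ioi_eq_neg_wronskian (h₁ : IsSolution (schrodingerMatrix a ζ₁) φ₁)
    (h₂ : IsSolution (schrodingerMatrix a ζ₂) φ₂) (hP : IsCoercivePotential a Λ A c R)
    (hζ₁ : ζ₁ ∈ halfPlane Λ) (hζ₂ : ζ₂ ∈ halfPlane Λ) (hb₁ : IsBoundedOn φ₁ (Ici 0))
    (hb₂ : IsBoundedOn φ₂ (Ici 0)) (b : ℝ) :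
    (ζ₂ - ζ₁) * ∫ x in Ioi b, φ₁ x 0 * φ₂ x 0 = -wronskian (φ₁ b) (φ₂ b) := by
  rw [← integral_const_mul, ← zero_sub]
  exact integral_Ioi_of_hasDerivAt_of_tendsto' (fun x _ => h₁.hasDerivAt_wronskian h₂ x)
    ((h₁.integrableOn_mul h₂ hP hζ₁ hζ₂ hb₁ hb₂ b).const_mul _)
    (tendsto_wronskian (h₁.tendsto_atTop hP hζ₁ hb₁) (h₂.tendsto_atTop hP hζ₂ hb₂))

lemma mul_intervalIntegral_eq_wronskian_sub (h₁ : IsSolution (schrodingerMatrix a ζ₁) φ₁)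
    (h₂ : IsSolution (schrodingerMatrix a ζ₂) φ₂) (x y : ℝ) :
    (ζ₂ - ζ₁) * ∫ s in y..x, φ₁ s 0 * φ₂ s 0 =
      wronskian (φ₁ x) (φ₂ x) - wronskian (φ₁ y) (φ₂ y) := by
  have hcont : Continuous fun s => (ζ₂ - ζ₁) * (φ₁ s 0 * φ₂ s 0) :=
    (((continuous_apply 0).comp h₁.continuous).mul
      ((continuous_apply 0).comp h₂.continuous)).const_mul _
  rw [← intervalIntegral.integral_const_mul]
  exact intervalIntegral.integral_eq_sub_of_hasDerivAt
    (fun s _ => h₁.hasDerivAt_wronskian h₂ s) (hcont.intervalIntegrable _ _)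

end IsSolution

/-- A family of solutions, one for each `ζ` with `Re ζ > Λ`, that are bounded on `[0, ∞)` and
normalised by `v(R) = 1`: the Jost solutions, up to normalisation. -/
structure IsJostFamily (a : ℝ → ℝ) (Λ R : ℝ) (φ : ℂ → ℝ → Fin 2 → ℂ) : Prop where
  isSolution : ∀ ζ ∈ halfPlane Λ, IsSolution (schrodingerMatrix a ζ) (φ ζ)
  isBoundedOn : ∀ ζ ∈ halfPlane Λ, IsBoundedOn (φ ζ) (Ici 0)
  apply_zero : ∀ ζ ∈ halfPlane Λ, φ ζ R 0 = 1

lemma exists_isJostFamily (hP : IsCoercivePotential a Λ A c R) : ∃ φ, IsJostFamily a Λ R φ := by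
  choose! φ hφ hb h1 using fun ζ (hζ : ζ ∈ halfPlane Λ) => exists_isSolution_isBoundedOn_Ici hP hζ
  exact ⟨φ, hφ, hb, h1⟩

lemma isOpen_halfPlane (Λ : ℝ) : IsOpen (halfPlane Λ) :=
  isOpen_lt continuous_const Complex.continuous_re

lemma eventually_norm_le_norm_add_one {E : Type*} [SeminormedAddCommGroup E] (ξ : E) :
    ∀ᶠ η in 𝓝 ξ, ‖η‖ ≤ ‖ξ‖ + 1 :=
  (continuous_norm.tendsto ξ).eventually (eventually_le_nhds (lt_add_one _))

namespace IsJostFamily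

variable {φ : ℂ → ℝ → Fin 2 → ℂ}

lemma exists_norm_le_exp (hφ : IsJostFamily a Λ R φ) (hP : IsCoercivePotential a Λ A c R) (t : ℝ) :
    ∃ D, ∀ ζ ∈ halfPlane Λ, ‖ζ‖ ≤ t → ∀ x, 0 ≤ x → ‖φ ζ x‖ ≤ D * Real.exp (-(c / 2) * x) := by
  set κ := lyapConst A c t
  have hκ : 0 < κ := lyapConst_pos hP.pos
  have hsqrt : 0 < √κ := Real.sqrt_pos.2 hκ
  refine ⟨Real.exp ((1 + A + t) * R) * (κ⁻¹ / √κ * Real.exp (c / 2 * R)), fun ζ hζ ht x hx => ?_⟩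
  have hc := hP.pos
  have hM0 : 0 ≤ 1 + A + t := by
    linarith [(abs_nonneg _).trans (hP.abs_le 0), (norm_nonneg ζ).trans ht]
  have hs := hφ.isSolution ζ hζ
  have hL : ∀ y, R ≤ y → lyap (φ ζ y) ≤ 0 := fun y => hs.lyap_nonpos hP hζ (hφ.isBoundedOn ζ hζ)
  have hdecay := hs.sqrt_lyapConst_mul_norm_le_exp hP hζ ht hL le_rfl (le_max_right x R)
  have hR := hs.norm_le_inv_lyapConst hP hζ ht (hL _ (by simp)) (hφ.apply_zero ζ hζ)
  calc ‖φ ζ x‖ ≤ Real.exp ((1 + A + t) * R) * ‖φ ζ (max x R)‖ :=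
        hs.norm_le_exp_mul_norm_max (norm_schrodingerMatrix_mulVec_le hP.abs_le ht) hM0 hP.nonneg hx
    _ ≤ Real.exp ((1 + A + t) * R) * (Real.exp (-(c / 2) * (max x R - R)) * κ⁻¹ / √κ) := by
        gcongr
        rw [le_div_iff₀' hsqrt]
        exact hdecay.trans (by gcongr)
    _ ≤ Real.exp ((1 + A + t) * R) * (Real.exp (-(c / 2) * (x - R)) * κ⁻¹ / √κ) := by
        have : -(c / 2) * (max x R - R) ≤ -(c / 2) * (x - R) := by
          nlinarith [le_max_left x R]
        gcongr
    _ = Real.exp ((1 + A + t) * R) * (κ⁻¹ / √κ * Real.exp (c / 2 * R)) *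
          Real.exp (-(c / 2) * x) := by
        rw [show -(c / 2) * (x - R) = c / 2 * R + -(c / 2) * x by ring, Real.exp_add]
        ring

/-- Variation of constants: the wronskian with `φ ζ₀` is controlled at `∞` and the wronskian with
`χ` at `R`. -/
lemma apply_eq (hφ : IsJostFamily a Λ R φ) (hP : IsCoercivePotential a Λ A c R)
    (hζ₀ : ζ₀ ∈ halfPlane Λ) (hζ : ζ ∈ halfPlane Λ) (hχ : IsSolution (schrodingerMatrix a ζ₀) χ)
    (hχR : χ R = ![0, 1]) (x : ℝ) :
    φ ζ x = φ ζ₀ x - (ζ - ζ₀) • ((∫ s in R..x, χ s 0 * φ ζ s 0) • φ ζ₀ x +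
      (∫ s in Ioi x, φ ζ₀ s 0 * φ ζ s 0) • χ x) := by
  have hs₀ := hφ.isSolution ζ₀ hζ₀
  have hs := hφ.isSolution ζ hζ
  have hwχ : (ζ - ζ₀) * ∫ s in R..x, χ s 0 * φ ζ s 0 = wronskian (χ x) (φ ζ x) + 1 := by
    rw [hχ.mul_intervalIntegral_eq_wronskian_sub hs, sub_eq_add_neg]
    simp [wronskian, hχR, hφ.apply_zero ζ hζ]
  have hwφ := hs₀.mul_integral_Ioi_eq_neg_wronskian hs hP hζ₀ hζ (hφ.isBoundedOn ζ₀ hζ₀)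
    (hφ.isBoundedOn ζ hζ) x
  have hw : wronskian (φ ζ₀ x) (χ x) = 1 :=
    (hs₀.wronskian_eq hχ x R).trans (by simp [wronskian, hχR, hφ.apply_zero ζ₀ hζ₀])
  rw [smul_add, smul_smul, smul_smul, hwχ, hwφ]
  ext i
  fin_cases i <;>
    simp only [Fin.zero_eta, Fin.mk_one, Pi.sub_apply, Pi.add_apply, Pi.smul_apply, smul_eq_mul,
      wronskian] at hw ⊢
  · linear_combination φ ζ x 0 * (-hw)
  · linear_combination φ ζ x 1 * (-hw)

lemma exists_eventually_norm_apply_zero_le (hφ : IsJostFamily a Λ R φ)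
    (hP : IsCoercivePotential a Λ A c R) (hζ₀ : ζ₀ ∈ halfPlane Λ) :
    ∃ D, 0 ≤ D ∧ ∀ᶠ ζ in 𝓝 ζ₀, ζ ∈ halfPlane Λ ∧
      ∀ s, 0 ≤ s → ‖φ ζ s 0‖ ≤ D * Real.exp (-(c / 2) * s) := by
  obtain ⟨D, hD⟩ := hφ.exists_norm_le_exp hP (‖ζ₀‖ + 1)
  refine ⟨max D 0, le_max_right _ _, ?_⟩
  filter_upwards [(isOpen_halfPlane Λ).mem_nhds hζ₀, eventually_norm_le_norm_add_one ζ₀]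
    with ζ hζ ht
  refine ⟨hζ, fun s hs => (norm_le_pi_norm _ 0).trans ((hD ζ hζ ht s hs).trans ?_)⟩
  gcongr
  exact le_max_left _ _

lemma exists_dominating_bounds (hφ : IsJostFamily a Λ R φ) (hP : IsCoercivePotential a Λ A c R)
    (hζ₀ : ζ₀ ∈ halfPlane Λ) (hχ : IsSolution (schrodingerMatrix a ζ₀) χ) {x : ℝ} (hx : 0 ≤ x) :
    ∃ g₁ g₂ : ℝ → ℝ, IntervalIntegrable g₁ volume R x ∧ IntegrableOn g₂ (Ioi x) ∧
      ∀ᶠ ζ in 𝓝 ζ₀, ζ ∈ halfPlane Λ ∧ (∀ s ∈ uIoc R x, ‖χ s 0 * φ ζ s 0‖ ≤ g₁ s) ∧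
        ∀ s ∈ Ioi x, ‖φ ζ₀ s 0 * φ ζ s 0‖ ≤ g₂ s := by
  obtain ⟨D, hD0, hD⟩ := hφ.exists_eventually_norm_apply_zero_le hP hζ₀
  have hD₀ := hD.self_of_nhds.2
  have hχ0 : Continuous fun s => χ s 0 := (continuous_apply 0).comp hχ.continuous
  refine ⟨fun s => ‖χ s 0‖ * (D * Real.exp (-(c / 2) * s)), fun s => D ^ 2 * Real.exp (-c * s),
    Continuous.intervalIntegrable (by fun_prop) _ _,
    (exp_neg_integrableOn_Ioi x hP.pos).const_mul _, ?_⟩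
  filter_upwards [hD] with ζ ⟨hζ, hle⟩
  refine ⟨hζ, fun s hs => ?_, fun s hs => ?_⟩
  · rw [norm_mul]
    exact mul_le_mul_of_nonneg_left (hle s ((le_min hP.nonneg hx).trans hs.1.le)) (norm_nonneg _)
  · have hs0 : 0 ≤ s := hx.trans (le_of_lt hs)
    calc ‖φ ζ₀ s 0 * φ ζ s 0‖
        ≤ (D * Real.exp (-(c / 2) * s)) * (D * Real.exp (-(c / 2) * s)) := by
          rw [norm_mul]
          gcongr
          exacts [hD₀ s hs0, hle s hs0]
      _ = D ^ 2 * Real.exp (-c * s) := by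
          rw [mul_mul_mul_comm, ← Real.exp_add]
          ring_nf

lemma continuousAt_apply (hφ : IsJostFamily a Λ R φ) (hP : IsCoercivePotential a Λ A c R)
    (hζ₀ : ζ₀ ∈ halfPlane Λ) {x : ℝ} (hx : 0 ≤ x) : ContinuousAt (fun ζ => φ ζ x) ζ₀ := by
  obtain ⟨χ, hχ, hχR⟩ := exists_isSolution_schrodingerMatrix hP.continuous hP.abs_le ζ₀ R ![0, 1]
  obtain ⟨g₁, g₂, hg₁, hg₂, hle⟩ := hφ.exists_dominating_bounds hP hζ₀ hχ hx
  set B := |∫ s in R..x, g₁ s| * ‖φ ζ₀ x‖ + (∫ s in Ioi x, g₂ s) * ‖χ x‖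
  have hlim : Tendsto (fun ζ => ‖ζ - ζ₀‖ * B) (𝓝 ζ₀) (𝓝 0) := by
    have : Continuous fun ζ => ‖ζ - ζ₀‖ * B := by fun_prop
    simpa using this.tendsto ζ₀
  refine tendsto_iff_norm_sub_tendsto_zero.2 (squeeze_zero' (.of_forall fun _ => norm_nonneg _) ?_
    hlim)
  filter_upwards [hle] with ζ ⟨hζ, hle₁, hle₂⟩
  rw [hφ.apply_eq hP hζ₀ hζ hχ hχR, sub_sub_cancel_left, norm_neg, norm_smul]
  refine mul_le_mul_of_nonneg_left (norm_add_le_of_le ?_ ?_) (norm_nonneg _) <;> rw [norm_smul]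
  · exact mul_le_mul_of_nonneg_right (intervalIntegral.norm_integral_le_abs_of_norm_le
      (ae_restrict_of_forall_mem measurableSet_uIoc hle₁) hg₁) (norm_nonneg _)
  · exact mul_le_mul_of_nonneg_right (norm_integral_le_of_norm_le hg₂
      (ae_restrict_of_forall_mem measurableSet_Ioi hle₂)) (norm_nonneg _)

lemma continuousAt_integral_Ioi (hφ : IsJostFamily a Λ R φ) (hP : IsCoercivePotential a Λ A c R)
    (hζ₀ : ζ₀ ∈ halfPlane Λ) {x : ℝ} (hx : 0 ≤ x) :
    ContinuousAt (fun ζ => ∫ s in Ioi x, φ ζ₀ s 0 * φ ζ s 0) ζ₀ := by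
  have hs₀ := hφ.isSolution ζ₀ hζ₀
  obtain ⟨_, g, _, hg, hle⟩ := hφ.exists_dominating_bounds hP hζ₀ hs₀ hx
  refine continuousAt_of_dominated (hle.mono fun ζ h => ?_)
    (hle.mono fun ζ h => ae_restrict_of_forall_mem measurableSet_Ioi h.2.2) hg
    (ae_restrict_of_forall_mem measurableSet_Ioi fun s hs => ?_)
  · exact (((continuous_apply 0).comp hs₀.continuous).mul
      ((continuous_apply 0).comp (hφ.isSolution ζ h.1).continuous)).aestronglyMeasurable
  · exact continuousAt_const.mul
      (continuousAt_pi.1 (hφ.continuousAt_apply hP hζ₀ (hx.trans (le_of_lt hs))) 0)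

lemma differentiableAt_apply (hφ : IsJostFamily a Λ R φ) (hP : IsCoercivePotential a Λ A c R)
    (hζ₀ : ζ₀ ∈ halfPlane Λ) {x : ℝ} (hx : 0 ≤ x) : DifferentiableAt ℂ (fun ζ => φ ζ x) ζ₀ := by
  obtain ⟨χ, hχ, hχR⟩ := exists_isSolution_schrodingerMatrix hP.continuous hP.abs_le ζ₀ R ![0, 1]
  obtain ⟨g, _, hg, _, hle⟩ := hφ.exists_dominating_bounds hP hζ₀ hχ hx
  have hI₁ : ContinuousAt (fun ζ => ∫ s in R..x, χ s 0 * φ ζ s 0) ζ₀ := by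
    refine intervalIntegral.continuousAt_of_dominated_interval (hle.mono fun ζ h => ?_)
      (hle.mono fun ζ h => .of_forall h.2.1) hg (.of_forall fun s hs => ?_)
    · exact (((continuous_apply 0).comp hχ.continuous).mul
        ((continuous_apply 0).comp (hφ.isSolution ζ h.1).continuous)).aestronglyMeasurable
    · exact continuousAt_const.mul (continuousAt_pi.1
        (hφ.continuousAt_apply hP hζ₀ ((le_min hP.nonneg hx).trans hs.1.le)) 0)
  have hI₂ := hφ.continuousAt_integral_Ioi hP hζ₀ hx
  have hH := (hI₁.smul (continuousAt_const (y := φ ζ₀ x))).add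
    (hI₂.smul (continuousAt_const (y := χ x)))
  refine (hasDerivAt_iff_tendsto_slope.2 ((hH.neg.tendsto.mono_left
    nhdsWithin_le_nhds).congr' ?_)).differentiableAt
  filter_upwards [self_mem_nhdsWithin,
    nhdsWithin_le_nhds ((isOpen_halfPlane Λ).mem_nhds hζ₀)] with ζ hne hζ
  rw [slope_def_module, hφ.apply_eq hP hζ₀ hζ hχ hχR, sub_sub_cancel_left, smul_neg,
    inv_smul_smul₀ (sub_ne_zero.2 hne)]
  rfl

theorem analyticOnNhd_apply (hφ : IsJostFamily a Λ R φ) (hP : IsCoercivePotential a Λ A c R)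
    {x : ℝ} (hx : 0 ≤ x) : AnalyticOnNhd ℂ (fun ζ => φ ζ x) (halfPlane Λ) :=
  DifferentiableOn.analyticOnNhd
    (fun _ hζ => (hφ.differentiableAt_apply hP hζ hx).differentiableWithinAt) (isOpen_halfPlane Λ)

end IsJostFamily

end Analyticity

section Eigenfunctions

variable {a : ℝ → ℝ} {Λ A c R : ℝ} {ζ ζ₁ ζ₂ : ℂ} {φ φ₁ φ₂ : ℝ → Fin 2 → ℂ}

lemma reflect_smul (k : ℂ) (φ : ℝ → Fin 2 → ℂ) : reflect (k • φ) = k • reflect φ := by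
  ext x i
  fin_cases i <;> simp [reflect]

lemma integrable_of_integrableOn_Ioi_of_comp_neg {E : Type*} [NormedAddCommGroup E] {f : ℝ → E}
    (h : IntegrableOn f (Ioi 0)) (h' : IntegrableOn (fun x => f (-x)) (Ioi 0)) :
    Integrable f := by
  rw [← integrableOn_univ, ← Iio_union_Ici (a := (0 : ℝ)), integrableOn_union,
    integrableOn_Ici_iff_integrableOn_Ioi]
  refine ⟨?_, h⟩
  rw [← (Measure.measurePreserving_neg (volume : Measure ℝ)).integrableOn_comp_preimage
    (Homeomorph.neg ℝ).measurableEmbedding]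
  simpa [Function.comp_def] using h'

namespace IsSolution

lemma exists_eq_smul_of_isBoundedOn_Ici (h₁ : IsSolution (schrodingerMatrix a ζ) φ₁)
    (h₂ : IsSolution (schrodingerMatrix a ζ) φ₂) (hP : IsCoercivePotential a Λ A c R)
    (hζ : ζ ∈ halfPlane Λ) (hb₁ : IsBoundedOn φ₁ (Ici 0)) (hb₂ : IsBoundedOn φ₂ (Ici 0))
    (hne : φ₁ ≠ 0) : ∃ k : ℂ, φ₂ = k • φ₁ :=
  h₁.exists_eq_smul_of_wronskian_eq_zero hP.abs_le h₂ hne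
    (h₁.wronskian_eq_zero h₂ hP hζ hb₁ hb₂ 0)

end IsSolution

/-- `φ` is an eigenfunction at the spectral parameter `ζ`: a non-trivial bounded solution. -/
structure IsEigenfunction (a : ℝ → ℝ) (ζ : ℂ) (φ : ℝ → Fin 2 → ℂ) : Prop where
  mem_boundedSolutions : φ ∈ boundedSolutions (schrodingerMatrix a ζ)
  ne_zero : φ ≠ 0

lemma isEigenfunction_of_isBoundedOn (hφ : IsSolution (schrodingerMatrix a ζ) φ)
    (hb : IsBoundedOn φ (Ici 0)) (hb' : IsBoundedOn φ (Iic 0)) (hne : φ ≠ 0) :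
    IsEigenfunction a ζ φ := by
  obtain ⟨C, hC⟩ := hb
  obtain ⟨D, hD⟩ := hb'
  exact ⟨⟨hφ, max C D, fun x => (le_total 0 x).elim (fun hx => (hC x hx).trans (le_max_left _ _))
    fun hx => (hD x hx).trans (le_max_right _ _)⟩, hne⟩

namespace IsEigenfunction

lemma isSolution (hφ : IsEigenfunction a ζ φ) : IsSolution (schrodingerMatrix a ζ) φ :=
  hφ.mem_boundedSolutions.1

lemma isBoundedOn (hφ : IsEigenfunction a ζ φ) (J : Set ℝ) : IsBoundedOn φ J :=
  hφ.mem_boundedSolutions.2.imp fun _ hC x _ => hC x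

lemma const_smul (hφ : IsEigenfunction a ζ φ) {k : ℂ} (hk : k ≠ 0) :
    IsEigenfunction a ζ (k • φ) :=
  ⟨Submodule.smul_mem _ k hφ.mem_boundedSolutions, smul_ne_zero hk hφ.ne_zero⟩

lemma star (hφ : IsEigenfunction a ζ φ) : IsEigenfunction a (conj ζ) (star φ) where
  mem_boundedSolutions := ⟨hφ.isSolution.star, hφ.mem_boundedSolutions.2.imp fun _ hC x =>
    (norm_star (φ x)).trans_le (hC x)⟩
  ne_zero := star_ne_zero.2 hφ.ne_zero

lemma reflect (hφ : IsEigenfunction a ζ φ) :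
    IsEigenfunction (fun x => a (-x)) ζ (reflect φ) where
  mem_boundedSolutions := ⟨hφ.isSolution.reflect, hφ.mem_boundedSolutions.2.imp fun _ hC x =>
    (norm_reflect φ x).trans_le (hC (-x))⟩
  ne_zero h := hφ.ne_zero (by
    rw [← reflect_reflect φ, h]
    ext x i
    fin_cases i <;> simp [FastEvans.reflect])

lemma exists_eq_smul (hφ : IsEigenfunction a ζ φ₁) (hP : IsCoercivePotential a Λ A c R)
    (hζ : ζ ∈ halfPlane Λ) (h₂ : IsSolution (schrodingerMatrix a ζ) φ₂)
    (hb₂ : IsBoundedOn φ₂ (Ici 0)) : ∃ k : ℂ, φ₂ = k • φ₁ :=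
  hφ.isSolution.exists_eq_smul_of_isBoundedOn_Ici h₂ hP hζ (hφ.isBoundedOn _) hb₂ hφ.ne_zero

lemma exists_eq_smul_reflect (hφ : IsEigenfunction a ζ φ₁) (hP : IsCoercivePotential a Λ A c R)
    (hζ : ζ ∈ halfPlane Λ) (h₂ : IsSolution (schrodingerMatrix (fun x => a (-x)) ζ) φ₂)
    (hb₂ : IsBoundedOn φ₂ (Ici 0)) : ∃ k : ℂ, FastEvans.reflect φ₂ = k • φ₁ := by
  obtain ⟨k, hk⟩ := hφ.reflect.exists_eq_smul hP.comp_neg hζ h₂ hb₂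
  exact ⟨k, by rw [hk, reflect_smul, reflect_reflect]⟩

lemma span_eq_boundedSolutions (hφ : IsEigenfunction a ζ φ) (hP : IsCoercivePotential a Λ A c R)
    (hζ : ζ ∈ halfPlane Λ) :
    Submodule.span ℂ {φ} = boundedSolutions (schrodingerMatrix a ζ) := by
  refine le_antisymm ((Submodule.span_singleton_le_iff_mem _ _).2 hφ.mem_boundedSolutions) ?_
  rintro χ ⟨hχ, hC⟩
  obtain ⟨k, rfl⟩ := hφ.exists_eq_smul hP hζ hχ (hC.imp fun _ hC x _ => hC x)
  exact Submodule.smul_mem _ k (Submodule.mem_span_singleton_self φ)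

lemma tendsto_atTop (hφ : IsEigenfunction a ζ φ) (hP : IsCoercivePotential a Λ A c R)
    (hζ : ζ ∈ halfPlane Λ) : Tendsto φ atTop (𝓝 0) :=
  hφ.isSolution.tendsto_atTop hP hζ (hφ.isBoundedOn _)

lemma tendsto_atBot (hφ : IsEigenfunction a ζ φ) (hP : IsCoercivePotential a Λ A c R)
    (hζ : ζ ∈ halfPlane Λ) : Tendsto φ atBot (𝓝 0) := by
  rw [tendsto_zero_iff_norm_tendsto_zero]
  refine ((hφ.reflect.tendsto_atTop hP.comp_neg hζ).norm.comp tendsto_neg_atBot_atTop).congr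
    (fun x => ?_) |>.trans_eq ?_
  · simp [norm_reflect]
  · simp

lemma integrable_mul (h₁ : IsEigenfunction a ζ₁ φ₁) (h₂ : IsEigenfunction a ζ₂ φ₂)
    (hP : IsCoercivePotential a Λ A c R) (hζ₁ : ζ₁ ∈ halfPlane Λ) (hζ₂ : ζ₂ ∈ halfPlane Λ) :
    Integrable fun x => φ₁ x 0 * φ₂ x 0 :=
  integrable_of_integrableOn_Ioi_of_comp_neg
    (h₁.isSolution.integrableOn_mul h₂.isSolution hP hζ₁ hζ₂ (h₁.isBoundedOn _)
      (h₂.isBoundedOn _) 0)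
    (h₁.reflect.isSolution.integrableOn_mul h₂.reflect.isSolution hP.comp_neg hζ₁ hζ₂
      (h₁.reflect.isBoundedOn _) (h₂.reflect.isBoundedOn _) 0)

lemma mul_integral_eq_zero (h₁ : IsEigenfunction a ζ₁ φ₁) (h₂ : IsEigenfunction a ζ₂ φ₂)
    (hP : IsCoercivePotential a Λ A c R) (hζ₁ : ζ₁ ∈ halfPlane Λ) (hζ₂ : ζ₂ ∈ halfPlane Λ) :
    (ζ₂ - ζ₁) * ∫ x, φ₁ x 0 * φ₂ x 0 = 0 := by
  rw [← integral_const_mul, ← sub_zero (0 : ℂ)]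
  exact integral_of_hasDerivAt_of_tendsto
    (fun x => h₁.isSolution.hasDerivAt_wronskian h₂.isSolution x)
    ((h₁.integrable_mul h₂ hP hζ₁ hζ₂).const_mul _)
    (tendsto_wronskian (h₁.tendsto_atBot hP hζ₁) (h₂.tendsto_atBot hP hζ₂))
    (tendsto_wronskian (h₁.tendsto_atTop hP hζ₁) (h₂.tendsto_atTop hP hζ₂))

lemma integral_star_mul_self_pos (hφ : IsEigenfunction a ζ φ)
    (hP : IsCoercivePotential a Λ A c R) (hζ : ζ ∈ halfPlane Λ) :
    0 < ∫ x, conj (φ x 0) * φ x 0 := by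
  have hint := hφ.star.integrable_mul hφ hP (by simpa [halfPlane] using hζ) hζ
  have hne : φ R 0 ≠ 0 :=
    hφ.isSolution.apply_zero_ne_zero hP hζ (hφ.isBoundedOn _) hφ.ne_zero le_rfl
  have hcont : Continuous fun x => ‖φ x 0‖ ^ 2 :=
    ((continuous_apply 0).comp hφ.isSolution.continuous).norm.pow 2
  simp only [Pi.star_apply, RCLike.star_def, RCLike.conj_mul] at hint ⊢
  norm_cast at hint ⊢
  exact Complex.zero_lt_real.2 (integral_pos_of_integrable_nonneg_nonzero hcont
    hint.re (fun _ => by positivity) (pow_ne_zero 2 (norm_ne_zero_iff.2 hne)))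

lemma conj_eq_self (hφ : IsEigenfunction a ζ φ) (hP : IsCoercivePotential a Λ A c R)
    (hζ : ζ ∈ halfPlane Λ) : conj ζ = ζ :=
  .symm <| sub_eq_zero.1 <| (mul_eq_zero.1
    (hφ.star.mul_integral_eq_zero hφ hP (by simpa [halfPlane] using hζ) hζ)).resolve_right
    (hφ.integral_star_mul_self_pos hP hζ).ne'

/-- An eigenfunction is a complex multiple of a real one, so `∫ v ^ 2` is a multiple of
`∫ ‖v‖ ^ 2`. -/
lemma integral_mul_self_ne_zero (hφ : IsEigenfunction a ζ φ)
    (hP : IsCoercivePotential a Λ A c R) (hζ : ζ ∈ halfPlane Λ) : ∫ x, φ x 0 * φ x 0 ≠ 0 := by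
  have hstar : IsSolution (schrodingerMatrix a ζ) (Star.star φ) := by
    simpa only [hφ.conj_eq_self hP hζ] using hφ.star.isSolution
  obtain ⟨k, hk⟩ := hφ.exists_eq_smul hP hζ hstar (hφ.star.isBoundedOn _)
  have hconj : ∀ x, conj (φ x 0) = k * φ x 0 := fun x => congrFun (congrFun hk x) 0
  have hint := (hφ.integral_star_mul_self_pos hP hζ).ne'
  simp only [hconj, mul_assoc, integral_const_mul] at hint
  exact right_ne_zero_of_mul hint

end IsEigenfunction

end Eigenfunctions

section JostWronskian

variable {a : ℝ → ℝ} {Λ A c R : ℝ} {ζ ζ₀ : ℂ} {φ ψ : ℂ → ℝ → Fin 2 → ℂ}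

lemma hasDerivAt_wronskian_comp {f g : ℂ → Fin 2 → ℂ} {f' g' : Fin 2 → ℂ}
    (hf : HasDerivAt f f' ζ₀) (hg : HasDerivAt g g' ζ₀) :
    HasDerivAt (fun ζ => wronskian (f ζ) (g ζ))
      (wronskian f' (g ζ₀) + wronskian (f ζ₀) g') ζ₀ := by
  rw [hasDerivAt_pi] at hf hg
  exact (((hf 0).mul (hg 1)).sub ((hf 1).mul (hg 0))).congr_deriv (by simp only [wronskian]; ring)

lemma hasDerivAt_wronskian_const_left {f : ℂ → Fin 2 → ℂ} {f' : Fin 2 → ℂ} (ξ : Fin 2 → ℂ)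
    (hf : HasDerivAt f f' ζ₀) :
    HasDerivAt (fun ζ => wronskian ξ (f ζ)) (wronskian ξ f') ζ₀ :=
  (hasDerivAt_wronskian_comp (hasDerivAt_const ζ₀ ξ) hf).congr_deriv (by simp [wronskian])

namespace IsJostFamily

lemma ne_zero (hφ : IsJostFamily a Λ R φ) (hζ : ζ ∈ halfPlane Λ) : φ ζ ≠ 0 :=
  fun h => by simpa [h] using hφ.apply_zero ζ hζ

lemma isSolution_reflect (hψ : IsJostFamily (fun x => a (-x)) Λ R ψ) (hζ : ζ ∈ halfPlane Λ) :
    IsSolution (schrodingerMatrix a ζ) (reflect (ψ ζ)) := by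
  simpa only [neg_neg] using (hψ.isSolution ζ hζ).reflect

lemma isBoundedOn_reflect (hψ : IsJostFamily a Λ R ψ) (hζ : ζ ∈ halfPlane Λ) :
    IsBoundedOn (reflect (ψ ζ)) (Iic 0) := by
  simpa using (hψ.isBoundedOn ζ hζ).reflect

lemma reflect_ne_zero (hψ : IsJostFamily a Λ R ψ) (hζ : ζ ∈ halfPlane Λ) : reflect (ψ ζ) ≠ 0 :=
  fun h => hψ.ne_zero hζ (by
    rw [← reflect_reflect (ψ ζ), h]; ext x i; fin_cases i <;> simp [reflect])

lemma analyticOnNhd_reflect (hψ : IsJostFamily a Λ R ψ) (hP : IsCoercivePotential a Λ A c R) :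
    AnalyticOnNhd ℂ (fun ζ => reflect (ψ ζ) 0) (halfPlane Λ) := by
  have h := analyticOnNhd_pi_iff.1 (hψ.analyticOnNhd_apply hP le_rfl)
  refine analyticOnNhd_pi_iff.2 (Fin.forall_fin_two.2 ⟨?_, ?_⟩)
  · simpa [reflect] using h 0
  · simpa [reflect] using! (h 1).neg

lemma boundedInitialData_Ici_eq_span (hφ : IsJostFamily a Λ R φ)
    (hP : IsCoercivePotential a Λ A c R) (hζ : ζ ∈ halfPlane Λ) :
    boundedInitialData (schrodingerMatrix a ζ) (Ici 0) = Submodule.span ℂ {φ ζ 0} := by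
  refine le_antisymm ?_ ((Submodule.span_singleton_le_iff_mem _ _).2
    ⟨_, hφ.isSolution ζ hζ, hφ.isBoundedOn ζ hζ, rfl⟩)
  rintro _ ⟨χ, hχ, hb, rfl⟩
  obtain ⟨k, rfl⟩ := (hφ.isSolution ζ hζ).exists_eq_smul_of_isBoundedOn_Ici hχ hP hζ
    (hφ.isBoundedOn ζ hζ) hb (hφ.ne_zero hζ)
  exact Submodule.smul_mem _ k (Submodule.mem_span_singleton_self _)

lemma boundedInitialData_Iic_eq_span (hψ : IsJostFamily (fun x => a (-x)) Λ R ψ)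
    (hP : IsCoercivePotential a Λ A c R) (hζ : ζ ∈ halfPlane Λ) :
    boundedInitialData (schrodingerMatrix a ζ) (Iic 0) = Submodule.span ℂ {reflect (ψ ζ) 0} := by
  refine le_antisymm ?_ ((Submodule.span_singleton_le_iff_mem _ _).2
    ⟨_, hψ.isSolution_reflect hζ, hψ.isBoundedOn_reflect hζ, rfl⟩)
  rintro _ ⟨χ, hχ, hb, rfl⟩
  obtain ⟨k, hk⟩ := (hψ.isSolution ζ hζ).exists_eq_smul_of_isBoundedOn_Ici hχ.reflect hP.comp_neg hζ
    (hψ.isBoundedOn ζ hζ) (by simpa using hb.reflect) (hψ.ne_zero hζ)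
  rw [← reflect_reflect χ, hk, reflect_smul]
  exact Submodule.smul_mem _ k (Submodule.mem_span_singleton_self _)

lemma hasDerivAt_wronskian (hφ : IsJostFamily a Λ R φ) (hP : IsCoercivePotential a Λ A c R)
    (hζ₀ : ζ₀ ∈ halfPlane Λ) :
    HasDerivAt (fun ζ => wronskian (φ ζ₀ 0) (φ ζ 0))
      (-∫ x in Ioi 0, φ ζ₀ x 0 * φ ζ₀ x 0) ζ₀ := by
  refine hasDerivAt_iff_tendsto_slope.2 (((hφ.continuousAt_integral_Ioi hP hζ₀
    le_rfl).neg.tendsto.mono_left nhdsWithin_le_nhds).congr' ?_)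
  filter_upwards [self_mem_nhdsWithin,
    nhdsWithin_le_nhds ((isOpen_halfPlane Λ).mem_nhds hζ₀)] with ζ hne hζ
  have hne' : ζ - ζ₀ ≠ 0 := sub_ne_zero.2 hne
  have h := (hφ.isSolution ζ₀ hζ₀).mul_integral_Ioi_eq_neg_wronskian (hφ.isSolution ζ hζ) hP hζ₀ hζ
    (hφ.isBoundedOn ζ₀ hζ₀) (hφ.isBoundedOn ζ hζ) 0
  have h0 : wronskian (φ ζ₀ 0) (φ ζ₀ 0) = 0 := by rw [wronskian]; ring
  rw [slope_def_field, h0, sub_zero, eq_div_iff hne', ← neg_eq_iff_eq_neg.2 h, mul_comm,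
    Pi.neg_apply,
    mul_neg]

lemma hasDerivAt_wronskian_reflect (hψ : IsJostFamily a Λ R ψ) (hP : IsCoercivePotential a Λ A c R)
    (hζ₀ : ζ₀ ∈ halfPlane Λ) :
    HasDerivAt (fun ζ => wronskian (reflect (ψ ζ₀) 0) (reflect (ψ ζ) 0))
      (∫ x in Ioi 0, ψ ζ₀ x 0 * ψ ζ₀ x 0) ζ₀ := by
  simpa only [wronskian_reflect, neg_zero, neg_neg] using! (hψ.hasDerivAt_wronskian hP hζ₀).neg

end IsJostFamily

/-- The wronskian at `x = 0` of the solution `φ ζ`, decaying at `∞`, and of the reflection of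
`ψ ζ`, decaying at `-∞`: every fast reduced Evans function is this one up to a non-vanishing
analytic factor. -/
def jostWronskian (φ ψ : ℂ → ℝ → Fin 2 → ℂ) (ζ : ℂ) : ℂ :=
  wronskian (φ ζ 0) (reflect (ψ ζ) 0)

lemma analyticOnNhd_jostWronskian (hP : IsCoercivePotential a Λ A c R)
    (hφ : IsJostFamily a Λ R φ) (hψ : IsJostFamily (fun x => a (-x)) Λ R ψ) :
    AnalyticOnNhd ℂ (jostWronskian φ ψ) (halfPlane Λ) := by
  have h₁ := analyticOnNhd_pi_iff.1 (hφ.analyticOnNhd_apply hP le_rfl)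
  have h₂ := analyticOnNhd_pi_iff.1 (hψ.analyticOnNhd_reflect hP.comp_neg)
  exact ((h₁ 0).mul (h₂ 1)).sub ((h₁ 1).mul (h₂ 0))

lemma isEigenfunction_of_jostWronskian_eq_zero (hP : IsCoercivePotential a Λ A c R)
    (hφ : IsJostFamily a Λ R φ) (hψ : IsJostFamily (fun x => a (-x)) Λ R ψ)
    (hζ : ζ ∈ halfPlane Λ) (h : jostWronskian φ ψ ζ = 0) : IsEigenfunction a ζ (φ ζ) := by
  obtain ⟨k, hk⟩ := (hψ.isSolution_reflect hζ).exists_eq_smul_of_wronskian_eq_zero hP.abs_le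
    (hφ.isSolution ζ hζ) (hψ.reflect_ne_zero hζ) (y := 0)
    (by rw [wronskian_swap]; exact neg_eq_zero.2 h)
  exact isEigenfunction_of_isBoundedOn (hφ.isSolution ζ hζ) (hφ.isBoundedOn ζ hζ)
    (hk ▸ (hψ.isBoundedOn_reflect hζ).const_smul k) (hφ.ne_zero hζ)

lemma jostWronskian_eq_zero_iff (hP : IsCoercivePotential a Λ A c R)
    (hφ : IsJostFamily a Λ R φ) (hψ : IsJostFamily (fun x => a (-x)) Λ R ψ)
    (hζ : ζ ∈ halfPlane Λ) : jostWronskian φ ψ ζ = 0 ↔ ∃ χ, IsEigenfunction a ζ χ := by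
  refine ⟨fun h => ⟨_, isEigenfunction_of_jostWronskian_eq_zero hP hφ hψ hζ h⟩, ?_⟩
  rintro ⟨χ, hχ⟩
  obtain ⟨k, hk⟩ := hχ.exists_eq_smul hP hζ (hφ.isSolution ζ hζ) (hφ.isBoundedOn ζ hζ)
  obtain ⟨l, hl⟩ := hχ.exists_eq_smul_reflect hP hζ (hψ.isSolution ζ hζ) (hψ.isBoundedOn ζ hζ)
  rw [jostWronskian, hk, hl]
  simp only [wronskian, Pi.smul_apply, smul_eq_mul]
  ring

lemma hasDerivAt_jostWronskian (hP : IsCoercivePotential a Λ A c R)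
    (hφ : IsJostFamily a Λ R φ) (hψ : IsJostFamily (fun x => a (-x)) Λ R ψ)
    (hζ₀ : ζ₀ ∈ halfPlane Λ) (hE : IsEigenfunction a ζ₀ (φ ζ₀)) {k : ℂ}
    (hk : reflect (ψ ζ₀) = k • φ ζ₀) :
    HasDerivAt (jostWronskian φ ψ) (k * ∫ x, φ ζ₀ x 0 * φ ζ₀ x 0) ζ₀ := by
  have hk0 : k ≠ 0 := fun h => hψ.reflect_ne_zero hζ₀ (by rw [hk, h, zero_smul])
  have hf := (hφ.differentiableAt_apply hP hζ₀ le_rfl).hasDerivAt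
  have hr := (hψ.analyticOnNhd_reflect hP.comp_neg ζ₀ hζ₀).differentiableAt.hasDerivAt
  refine (hasDerivAt_wronskian_comp hf hr).congr_deriv (mul_left_cancel₀ hk0 ?_)
  have hIoi := (hasDerivAt_wronskian_const_left (φ ζ₀ 0) hf).unique
    (hφ.hasDerivAt_wronskian hP hζ₀)
  have hIio := (hasDerivAt_wronskian_const_left (reflect (ψ ζ₀) 0) hr).unique
    (hψ.hasDerivAt_wronskian_reflect hP.comp_neg hζ₀)
  have hψk : ∀ x, ψ ζ₀ x 0 = k * φ ζ₀ (-x) 0 := fun x => by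
    simpa [reflect] using congrFun (congrFun hk (-x)) 0
  have hsplit := intervalIntegral.integral_Iic_add_Ioi (b := 0)
    (hE.integrable_mul hE hP hζ₀ hζ₀).integrableOn (hE.integrable_mul hE hP hζ₀ hζ₀).integrableOn
  rw [← neg_zero, ← integral_comp_neg_Ioi, neg_zero] at hsplit
  simp only [hψk, mul_mul_mul_comm k, integral_const_mul] at hIio
  rw [hk, Pi.smul_apply, wronskian_smul_left] at hIio
  rw [wronskian_swap, hk, Pi.smul_apply, wronskian_smul_left, hIoi, mul_add, hIio, ← hsplit]
  ring

lemma deriv_jostWronskian_ne_zero (hP : IsCoercivePotential a Λ A c R)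
    (hφ : IsJostFamily a Λ R φ) (hψ : IsJostFamily (fun x => a (-x)) Λ R ψ)
    (hζ₀ : ζ₀ ∈ halfPlane Λ) (h : jostWronskian φ ψ ζ₀ = 0) :
    deriv (jostWronskian φ ψ) ζ₀ ≠ 0 := by
  have hE := isEigenfunction_of_jostWronskian_eq_zero hP hφ hψ hζ₀ h
  obtain ⟨k, hk⟩ := hE.exists_eq_smul_reflect hP hζ₀ (hψ.isSolution ζ₀ hζ₀)
    (hψ.isBoundedOn ζ₀ hζ₀)
  rw [(hasDerivAt_jostWronskian hP hφ hψ hζ₀ hE hk).deriv]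
  refine mul_ne_zero (fun hk0 => hψ.reflect_ne_zero hζ₀ ?_) (hE.integral_mul_self_ne_zero hP hζ₀)
  rw [hk, hk0, zero_smul]

end JostWronskian

section EvansFunction

lemma exists_eventuallyEq_smul_of_span_eq {ι : Type*} [Fintype ι] {B₁ B₂ : ℂ → ι → ℂ} {ζ₀ : ℂ}
    (h₁ : AnalyticAt ℂ B₁ ζ₀) (h₂ : AnalyticAt ℂ B₂ ζ₀) (hne : B₂ ζ₀ ≠ 0)
    (hspan : ∀ᶠ ζ in 𝓝 ζ₀, Submodule.span ℂ {B₁ ζ} = Submodule.span ℂ {B₂ ζ}) :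
    ∃ α : ℂ → ℂ, AnalyticAt ℂ α ζ₀ ∧ α ζ₀ ≠ 0 ∧ ∀ᶠ ζ in 𝓝 ζ₀, B₂ ζ = α ζ • B₁ ζ := by
  have hsmul : ∀ᶠ ζ in 𝓝 ζ₀, ∃ k : ℂ, k • B₁ ζ = B₂ ζ := hspan.mono fun ζ h =>
    Submodule.mem_span_singleton.1 (h ▸ Submodule.mem_span_singleton_self _)
  obtain ⟨i, hi⟩ := Function.ne_iff.1 hne
  obtain ⟨k₀, hk₀⟩ := hsmul.self_of_nhds
  have hi₁ : B₁ ζ₀ i ≠ 0 := fun h => hi (by simp [← hk₀, h])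
  have h₁i := analyticAt_pi_iff.1 h₁ i
  refine ⟨fun ζ => B₂ ζ i / B₁ ζ i, (analyticAt_pi_iff.1 h₂ i).div h₁i hi₁, div_ne_zero hi hi₁, ?_⟩
  filter_upwards [hsmul, h₁i.continuousAt.eventually_ne hi₁] with ζ ⟨k, hk⟩ hne
  rw [← hk, Pi.smul_apply, smul_eq_mul, mul_div_cancel_right₀ _ hne]

variable {a : ℝ → ℝ} {Λ A c R : ℝ} {ζ ζ₀ : ℂ} {φ ψ : ℂ → ℝ → Fin 2 → ℂ} {E : ℂ → ℂ}

theorem exists_isFastReducedEvans (hP : IsCoercivePotential a Λ A c R) :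
    ∃ E, IsFastReducedEvans (schrodingerMatrix a) Λ E := by
  obtain ⟨φ, hφ⟩ := exists_isJostFamily hP
  obtain ⟨ψ, hψ⟩ := exists_isJostFamily hP.comp_neg
  choose! K μ Pp hPp using fun ζ (hζ : ζ ∈ halfPlane Λ) => exists_hasExpDichotomyOn_Ici hP hζ
  choose! K' μ' Pm hPm using fun ζ (hζ : ζ ∈ halfPlane Λ) => exists_hasExpDichotomyOn_Iic hP hζ
  have hM : ∀ ζ, ∀ x ξ, ‖schrodingerMatrix a ζ x *ᵥ ξ‖ ≤ (1 + A + ‖ζ‖) * ‖ξ‖ := fun ζ =>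
    norm_schrodingerMatrix_mulVec_le hP.abs_le le_rfl
  refine ⟨jostWronskian φ ψ, Pp, Pm, fun ζ => φ ζ 0, fun ζ => reflect (ψ ζ) 0,
    fun ζ hζ => ⟨_, _, hPp ζ hζ⟩, fun ζ hζ => ⟨_, _, hPm ζ hζ⟩, hφ.analyticOnNhd_apply hP le_rfl,
    hψ.analyticOnNhd_reflect hP.comp_neg, fun ζ hζ => ⟨fun h => ?_, ?_, fun h => ?_, ?_, ?_⟩⟩
  · exact hφ.ne_zero hζ ((hφ.isSolution ζ hζ).eq_zero_of_apply_eq_zero (hM ζ) h)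
  · rw [(hPp ζ hζ).range_eq (hM ζ), hφ.boundedInitialData_Ici_eq_span hP hζ]
  · exact hψ.reflect_ne_zero hζ ((hψ.isSolution_reflect hζ).eq_zero_of_apply_eq_zero (hM ζ) h)
  · rw [(hPm ζ hζ).ker_eq (hM ζ), hψ.boundedInitialData_Iic_eq_span hP hζ]
  · rw [det_transpose_of_eq_wronskian, jostWronskian]

namespace IsFastReducedEvans

lemma exists_eventuallyEq_mul_jostWronskian (hE : IsFastReducedEvans (schrodingerMatrix a) Λ E)
    (hP : IsCoercivePotential a Λ A c R) (hφ : IsJostFamily a Λ R φ)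
    (hψ : IsJostFamily (fun x => a (-x)) Λ R ψ) (hζ₀ : ζ₀ ∈ halfPlane Λ) :
    ∃ γ : ℂ → ℂ, AnalyticAt ℂ γ ζ₀ ∧ γ ζ₀ ≠ 0 ∧ E =ᶠ[𝓝 ζ₀] fun ζ => γ ζ * jostWronskian φ ψ ζ := by
  obtain ⟨Pp, Pm, Bu, Bs, hPp, hPm, hBu, hBs, hB⟩ := hE
  have hhalf : ∀ᶠ ζ in 𝓝 ζ₀, ζ ∈ halfPlane Λ := (isOpen_halfPlane Λ).mem_nhds hζ₀
  have hM : ∀ ζ, ∀ x ξ, ‖schrodingerMatrix a ζ x *ᵥ ξ‖ ≤ (1 + A + ‖ζ‖) * ‖ξ‖ := fun ζ =>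
    norm_schrodingerMatrix_mulVec_le hP.abs_le le_rfl
  obtain ⟨α, hα, hα0, hαB⟩ := exists_eventuallyEq_smul_of_span_eq
    (hφ.analyticOnNhd_apply hP le_rfl ζ₀ hζ₀) (hBu ζ₀ hζ₀) (hB ζ₀ hζ₀).1 (hhalf.mono fun ζ hζ => by
      obtain ⟨K, μ, h⟩ := hPp ζ hζ
      rw [(hB ζ hζ).2.1, h.range_eq (hM ζ), hφ.boundedInitialData_Ici_eq_span hP hζ])
  obtain ⟨β, hβ, hβ0, hβB⟩ := exists_eventuallyEq_smul_of_span_eq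
    (hψ.analyticOnNhd_reflect hP.comp_neg ζ₀ hζ₀) (hBs ζ₀ hζ₀) (hB ζ₀ hζ₀).2.2.1
    (hhalf.mono fun ζ hζ => by
      obtain ⟨K, μ, h⟩ := hPm ζ hζ
      rw [(hB ζ hζ).2.2.2.1, h.ker_eq (hM ζ), hψ.boundedInitialData_Iic_eq_span hP hζ])
  refine ⟨fun ζ => α ζ * β ζ, hα.mul hβ, mul_ne_zero hα0 hβ0, ?_⟩
  filter_upwards [hαB, hβB, hhalf] with ζ hαζ hβζ hζ
  rw [(hB ζ hζ).2.2.2.2, det_transpose_of_eq_wronskian, hαζ, hβζ, wronskian_smul_left,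
    wronskian_smul_right, mul_assoc, jostWronskian]

theorem eq_zero_iff (hE : IsFastReducedEvans (schrodingerMatrix a) Λ E)
    (hP : IsCoercivePotential a Λ A c R) (hζ : ζ ∈ halfPlane Λ) :
    E ζ = 0 ↔ ∃ χ, IsEigenfunction a ζ χ := by
  obtain ⟨φ, hφ⟩ := exists_isJostFamily hP
  obtain ⟨ψ, hψ⟩ := exists_isJostFamily hP.comp_neg
  obtain ⟨γ, -, hγ0, hγ⟩ := hE.exists_eventuallyEq_mul_jostWronskian hP hφ hψ hζ
  rw [hγ.eq_of_nhds, mul_eq_zero_iff_left hγ0, jostWronskian_eq_zero_iff hP hφ hψ hζ]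

theorem analyticOrderAt_eq_one (hE : IsFastReducedEvans (schrodingerMatrix a) Λ E)
    (hP : IsCoercivePotential a Λ A c R) (hζ : ζ ∈ halfPlane Λ) (h : E ζ = 0) :
    analyticOrderAt E ζ = 1 := by
  obtain ⟨φ, hφ⟩ := exists_isJostFamily hP
  obtain ⟨ψ, hψ⟩ := exists_isJostFamily hP.comp_neg
  obtain ⟨γ, hγan, hγ0, hγ⟩ := hE.exists_eventuallyEq_mul_jostWronskian hP hφ hψ hζ
  have hD : jostWronskian φ ψ ζ = 0 :=
    (mul_eq_zero.1 (hγ.eq_of_nhds.symm.trans h)).resolve_left hγ0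
  have hDan := analyticOnNhd_jostWronskian hP hφ hψ ζ hζ
  have hD1 : analyticOrderAt (jostWronskian φ ψ) ζ = 1 :=
    hDan.analyticOrderAt_eq_one_of_zero_deriv_ne_zero hD
      (deriv_jostWronskian_ne_zero hP hφ hψ hζ hD)
  rw [analyticOrderAt_congr hγ]
  exact (analyticOrderAt_mul hγan hDan).trans
    (by rw [hγan.analyticOrderAt_eq_zero.2 hγ0, hD1, zero_add])

end IsFastReducedEvans

end EvansFunction

section Sturm

lemma ofReal_mem_halfPlane {Λ l : ℝ} : (l : ℂ) ∈ halfPlane Λ ↔ Λ < l := by simp [halfPlane]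

lemma setIntegral_pos_of_forall_pos {α : Type*} [MeasurableSpace α] {μ : Measure α} {s : Set α}
    {f : α → ℂ} (hs : MeasurableSet s) (hμ : μ s ≠ 0) (hf : IntegrableOn f s μ)
    (hpos : ∀ x ∈ s, 0 < f x) : 0 < ∫ x in s, f x ∂μ := by
  have hre : ∀ x ∈ s, f x = ((f x).re : ℂ) := fun x hx =>
    Complex.eq_re_of_ofReal_le (hpos x hx).le
  have hre_pos : ∀ x ∈ s, 0 < (f x).re := fun x hx => (Complex.pos_iff.1 (hpos x hx)).1
  rw [setIntegral_congr_fun hs hre, integral_complex_ofReal]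
  refine Complex.zero_lt_real.2 ((setIntegral_pos_iff_support_of_nonneg_ae
    ((ae_restrict_iff' hs).2 (.of_forall fun x hx => (hre_pos x hx).le)) hf.re).2 ?_)
  rw [inter_eq_right.2 (show s ⊆ Function.support _ from fun x hx => (hre_pos x hx).ne')]
  exact hμ.bot_lt

lemma nonneg_of_hasDerivAt_of_Ioi {f : ℝ → ℂ} {f' : ℂ} {b : ℝ} (hf : HasDerivAt f f' b)
    (h0 : f b = 0) (hnonneg : ∀ x ∈ Ioi b, 0 ≤ f x) : 0 ≤ f' := by
  refine ge_of_tendsto ((hasDerivAt_iff_tendsto_slope.1 hf).mono_left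
    (nhdsWithin_mono b fun x (hx : x ∈ Ioi b) => ne_of_gt hx)) ?_
  filter_upwards [self_mem_nhdsWithin] with x hx
  rw [slope_def_module, h0, sub_zero]
  exact smul_nonneg (inv_nonneg.2 (sub_nonneg.2 (le_of_lt hx))) (hnonneg x hx)

variable {a : ℝ → ℝ} {Λ A c R l l₁ l₂ : ℝ} {φ φ₁ φ₂ : ℝ → Fin 2 → ℂ}

namespace IsSolution

lemma star_eq_self (hφ : IsSolution (schrodingerMatrix a l) φ)
    (hP : IsCoercivePotential a Λ A c R) (hl : Λ < l) (hb : IsBoundedOn φ (Ici 0)) {y : ℝ}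
    (hy : φ y 0 = 1) : Star.star φ = φ := by
  have hstar : IsSolution (schrodingerMatrix a l) (Star.star φ) := by
    simpa only [Complex.conj_ofReal] using hφ.star
  obtain ⟨k, hk⟩ := hφ.exists_eq_smul_of_isBoundedOn_Ici hstar hP (ofReal_mem_halfPlane.2 hl) hb
    (hb.imp fun _ hC x hx => (norm_star (φ x)).trans_le (hC x hx)) fun h => by simp [h] at hy
  have hk1 := congrFun (congrFun hk y) 0
  simp only [Pi.star_apply, Pi.smul_apply, hy, star_one, smul_eq_mul, mul_one] at hk1
  rw [hk, ← hk1, one_smul]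

lemma exists_smul_pos (hφ : IsSolution (schrodingerMatrix a l) φ)
    (hP : IsCoercivePotential a Λ A c R) (hl : Λ < l) (hb : IsBoundedOn φ (Ici 0)) {s : Set ℝ}
    (hs : IsConnected s) (hne : ∀ x ∈ s, φ x 0 ≠ 0) :
    ∃ k : ℂ, k ≠ 0 ∧ ∀ x ∈ s, 0 < (k • φ) x 0 := by
  obtain ⟨y, hy⟩ := hs.nonempty
  have hk : (φ y 0)⁻¹ ≠ 0 := inv_ne_zero (hne y hy)
  have hky : ((φ y 0)⁻¹ • φ) y 0 = 1 := inv_mul_cancel₀ (hne y hy)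
  refine ⟨_, hk, fun x hx => ?_⟩
  have hstar := (hφ.const_smul (φ y 0)⁻¹).star_eq_self hP hl (hb.const_smul _) hky
  have him : ∀ x, (((φ y 0)⁻¹ • φ) x 0).im = 0 := fun x =>
    Complex.conj_eq_iff_im.1 (congrFun (congrFun hstar x) 0)
  refine Complex.pos_iff.2 ⟨?_, (him x).symm⟩
  by_contra! hneg
  obtain ⟨z, hz, hz0⟩ := hs.isPreconnected.intermediate_value hx hy
    (f := fun x => (((φ y 0)⁻¹ • φ) x 0).re)
    (Complex.continuous_re.comp ((continuous_apply 0).comp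
      (hφ.const_smul (φ y 0)⁻¹).continuous)).continuousOn
    (show (0 : ℝ) ∈ Icc _ _ from ⟨hneg, by simp only [hky, Complex.one_re, zero_le_one]⟩)
  exact mul_ne_zero hk (hne z hz) (Complex.ext hz0 (him z))

/-- Both `φ₁ b` and, as `φ₂` vanishes at `b`, also `φ₂' b` are nonnegative, so the boundary term
of the Lagrange identity for `(l₂ - l₁) ∫ φ₁ φ₂` over `(b, ∞)` has the wrong sign if `l₁ < l₂`. -/
lemma le_of_forall_Ioi_pos (h₁ : IsSolution (schrodingerMatrix a l₁) φ₁)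
    (h₂ : IsSolution (schrodingerMatrix a l₂) φ₂) (hP : IsCoercivePotential a Λ A c R)
    (hl₁ : Λ < l₁) (hl₂ : Λ < l₂) (hb₁ : IsBoundedOn φ₁ (Ici 0)) (hb₂ : IsBoundedOn φ₂ (Ici 0))
    {b : ℝ} (hpos₁ : ∀ x ∈ Ioi b, 0 < φ₁ x 0) (hpos₂ : ∀ x ∈ Ioi b, 0 < φ₂ x 0)
    (h0 : φ₂ b 0 = 0) : l₂ ≤ l₁ := by
  have hζ₁ := ofReal_mem_halfPlane.2 hl₁
  have hζ₂ := ofReal_mem_halfPlane.2 hl₂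
  have hφ₁ : 0 ≤ φ₁ b 0 := ge_of_tendsto
    ((h₁.hasDerivAt_zero b).continuousAt.tendsto.mono_left nhdsWithin_le_nhds)
    (by filter_upwards [self_mem_nhdsWithin] with x hx using (hpos₁ x hx).le)
  have hφ₂ : 0 ≤ φ₂ b 1 := nonneg_of_hasDerivAt_of_Ioi (h₂.hasDerivAt_zero b) h0
    fun x hx => (hpos₂ x hx).le
  have hint : 0 < ∫ x in Ioi b, φ₁ x 0 * φ₂ x 0 :=
    setIntegral_pos_of_forall_pos measurableSet_Ioi (by simp)
      (h₁.integrableOn_mul h₂ hP hζ₁ hζ₂ hb₁ hb₂ b) fun x hx => mul_pos (hpos₁ x hx) (hpos₂ x hx)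
  have hlagrange := h₁.mul_integral_Ioi_eq_neg_wronskian h₂ hP hζ₁ hζ₂ hb₁ hb₂ b
  rw [wronskian, h0, mul_zero, sub_zero] at hlagrange
  by_contra! hlt
  have hlt' : (0 : ℂ) < l₂ - l₁ := sub_pos.2 (Complex.real_lt_real.2 hlt)
  exact (mul_pos hlt' hint).not_ge (hlagrange.trans_le (neg_nonpos.2 (mul_nonneg hφ₁ hφ₂)))

lemma apply_zero_ne_zero_of_lt (h₁ : IsSolution (schrodingerMatrix a l₁) φ₁)
    (h₂ : IsSolution (schrodingerMatrix a l₂) φ₂) (hP : IsCoercivePotential a Λ A c R)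
    (hl₁ : Λ < l₁) (hlt : l₁ < l₂) (hb₁ : IsBoundedOn φ₁ (Ici 0)) (hb₂ : IsBoundedOn φ₂ (Ici 0))
    (hne : φ₂ ≠ 0) {b : ℝ} (hne₁ : ∀ x ∈ Ioi b, φ₁ x 0 ≠ 0) : φ₂ b 0 ≠ 0 := by
  intro h0
  have hl₂ := hl₁.trans hlt
  have hlarge : ∀ x, R ≤ x → φ₂ x 0 ≠ 0 := fun x =>
    h₂.apply_zero_ne_zero hP (ofReal_mem_halfPlane.2 hl₂) hb₂ hne
  have hcont : Continuous fun x => φ₂ x 0 := (continuous_apply 0).comp h₂.continuous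
  have hbR : b ≤ R := le_of_not_ge fun h => hlarge b h h0
  obtain ⟨z, ⟨⟨hbz, _⟩, hz0⟩, hlast⟩ := (isCompact_Icc.inter_right
    (isClosed_singleton.preimage hcont)).exists_isGreatest (α := ℝ) ⟨b, left_mem_Icc.2 hbR, h0⟩
  have hne₂ : ∀ x ∈ Ioi z, φ₂ x 0 ≠ 0 := fun x hx hx0 =>
    (le_total x R).elim (fun hxR => (hlast ⟨⟨hbz.trans hx.le, hxR⟩, hx0⟩).not_gt hx)
      fun hRx => hlarge x hRx hx0
  obtain ⟨k₁, -, hpos₁⟩ := h₁.exists_smul_pos hP hl₁ hb₁ isConnected_Ioi fun x hx =>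
    hne₁ x (lt_of_le_of_lt hbz hx)
  obtain ⟨k₂, -, hpos₂⟩ := h₂.exists_smul_pos hP hl₂ hb₂ isConnected_Ioi hne₂
  exact hlt.not_ge ((h₁.const_smul k₁).le_of_forall_Ioi_pos (h₂.const_smul k₂) hP hl₁ hl₂
    (hb₁.const_smul k₁) (hb₂.const_smul k₂) hpos₁ hpos₂ (mul_eq_zero_of_right _ hz0))

end IsSolution

namespace IsEigenfunction

theorem apply_zero_ne_zero_of_lt (h₁ : IsEigenfunction a l₁ φ₁) (h₂ : IsEigenfunction a l₂ φ₂)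
    (hP : IsCoercivePotential a Λ A c R) (hl₁ : Λ < l₁) (hlt : l₁ < l₂) {x₀ : ℝ}
    (hne : ∀ x, x ≠ x₀ → φ₁ x 0 ≠ 0) (x : ℝ) : φ₂ x 0 ≠ 0 := by
  rcases le_total x₀ x with hx | hx
  · exact h₁.isSolution.apply_zero_ne_zero_of_lt h₂.isSolution hP hl₁ hlt (h₁.isBoundedOn _)
      (h₂.isBoundedOn _) h₂.ne_zero fun y hy => hne y (lt_of_le_of_lt hx hy).ne'
  · have h := h₁.reflect.isSolution.apply_zero_ne_zero_of_lt h₂.reflect.isSolution hP.comp_neg hl₁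
      hlt (h₁.reflect.isBoundedOn _) (h₂.reflect.isBoundedOn _) h₂.reflect.ne_zero (b := -x)
      fun y hy => hne (-y) (by linarith [mem_Ioi.1 hy] : -y < x₀).ne
    simpa [FastEvans.reflect] using h

/-- Two eigenfunctions without zeros cannot be orthogonal. -/
lemma eq_of_apply_zero_ne_zero (h₁ : IsEigenfunction a l₁ φ₁) (h₂ : IsEigenfunction a l₂ φ₂)
    (hP : IsCoercivePotential a Λ A c R) (hl₁ : Λ < l₁) (hl₂ : Λ < l₂)
    (hne₁ : ∀ x, φ₁ x 0 ≠ 0) (hne₂ : ∀ x, φ₂ x 0 ≠ 0) : l₁ = l₂ := by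
  have hζ₁ := ofReal_mem_halfPlane.2 hl₁
  have hζ₂ := ofReal_mem_halfPlane.2 hl₂
  obtain ⟨k₁, hk₁, hpos₁⟩ := h₁.isSolution.exists_smul_pos hP hl₁ (h₁.isBoundedOn _)
    isConnected_univ fun x _ => hne₁ x
  obtain ⟨k₂, hk₂, hpos₂⟩ := h₂.isSolution.exists_smul_pos hP hl₂ (h₂.isBoundedOn _)
    isConnected_univ fun x _ => hne₂ x
  have hint := setIntegral_pos_of_forall_pos MeasurableSet.univ (by simp)
    ((h₁.const_smul hk₁).integrable_mul (h₂.const_smul hk₂) hP hζ₁ hζ₂).integrableOn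
    fun x hx => mul_pos (hpos₁ x hx) (hpos₂ x hx)
  rw [setIntegral_univ] at hint
  have horth := (h₁.const_smul hk₁).mul_integral_eq_zero (h₂.const_smul hk₂) hP hζ₁ hζ₂
  exact_mod_cast (sub_eq_zero.1 ((mul_eq_zero.1 horth).resolve_right hint.ne')).symm

end IsEigenfunction

end Sturm

section LargerEigenvalue

variable {a : ℝ → ℝ} {Λ A c R l : ℝ} {φ ψ : ℂ → ℝ → Fin 2 → ℂ}

lemma IsSolution.apply_pos_and_apply_neg {χ : ℝ → Fin 2 → ℂ}
    (hχ : IsSolution (schrodingerMatrix a l) χ) (hP : IsCoercivePotential a Λ A c 0) (hl : Λ < l)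
    (hb : IsBoundedOn χ (Ici 0)) {y : ℝ} (hy : 0 ≤ y) (h1 : χ y 0 = 1) :
    0 < χ 0 0 ∧ χ 0 1 < 0 := by
  have hζ := ofReal_mem_halfPlane.2 hl
  have hne : χ ≠ 0 := fun h => by simp [h] at h1
  obtain ⟨k, -, hk⟩ := hχ.exists_smul_pos hP hl hb isConnected_Ici fun x hx =>
    hχ.apply_zero_ne_zero hP hζ hb hne hx
  have hkpos : 0 < k := by simpa [h1] using hk y hy
  have hpos : 0 < χ 0 0 := (mul_pos_iff_of_pos_left hkpos).1 (hk 0 self_mem_Ici)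
  have him : (χ 0 1).im = 0 := Complex.conj_eq_iff_im.1
    (congrFun (congrFun (hχ.star_eq_self hP hl hb h1) 0) 1)
  have hlyap := hχ.lyap_neg hP hζ hb hne le_rfl
  rw [lyap, Complex.inner, Complex.mul_re, him, zero_mul, sub_zero, Complex.conj_re] at hlyap
  exact ⟨hpos, Complex.neg_iff.2
    ⟨neg_of_mul_neg_left hlyap (Complex.pos_iff.1 hpos).1.le, him⟩⟩

lemma jostWronskian_im_eq_zero (hP : IsCoercivePotential a Λ A c R)
    (hφ : IsJostFamily a Λ R φ) (hψ : IsJostFamily (fun x => a (-x)) Λ R ψ) (hl : Λ < l) :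
    (jostWronskian φ ψ l).im = 0 := by
  have hζ := ofReal_mem_halfPlane.2 hl
  have hφl : ∀ i, conj (φ l 0 i) = φ l 0 i := congrFun (congrFun
    ((hφ.isSolution l hζ).star_eq_self hP hl (hφ.isBoundedOn l hζ) (hφ.apply_zero l hζ)) 0)
  have hψl : ∀ i, conj (ψ l 0 i) = ψ l 0 i := congrFun (congrFun
    ((hψ.isSolution l hζ).star_eq_self hP.comp_neg hl (hψ.isBoundedOn l hζ)
      (hψ.apply_zero l hζ)) 0)
  rw [← Complex.conj_eq_iff_im]
  simp [jostWronskian, wronskian, reflect, hφl, hψl]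

lemma jostWronskian_pos (hP : IsCoercivePotential a Λ A c R)
    (hφ : IsJostFamily a Λ R φ) (hψ : IsJostFamily (fun x => a (-x)) Λ R ψ) (hΛ : Λ < l)
    (hl : A + 1 < l) : 0 < jostWronskian φ ψ l := by
  have hζ := ofReal_mem_halfPlane.2 hΛ
  have hP₀ : IsCoercivePotential a (A + 1) A 1 0 :=
    ⟨hP.continuous, hP.abs_le, one_pos, le_rfl, le_rfl, fun x _ => by
      linarith [neg_le_of_abs_le (hP.abs_le x)]⟩
  obtain ⟨hφ₀, hφ₁⟩ := (hφ.isSolution l hζ).apply_pos_and_apply_neg hP₀ hl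
    (hφ.isBoundedOn l hζ) hP.nonneg (hφ.apply_zero l hζ)
  obtain ⟨hψ₀, hψ₁⟩ := (hψ.isSolution l hζ).apply_pos_and_apply_neg hP₀.comp_neg hl
    (hψ.isBoundedOn l hζ) hP.nonneg (hψ.apply_zero l hζ)
  simpa [jostWronskian, wronskian, reflect] using
    add_pos (mul_pos hφ₀ (neg_pos.2 hψ₁)) (mul_pos (neg_pos.2 hφ₁) hψ₀)

lemma exists_hasDerivAt_jostWronskian_neg {χ : ℝ → Fin 2 → ℂ} (hχ : IsEigenfunction a l χ)
    (hP : IsCoercivePotential a Λ A c R) (hφ : IsJostFamily a Λ R φ)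
    (hψ : IsJostFamily (fun x => a (-x)) Λ R ψ) (hl : Λ < l) (hsign : χ (-R) 0 / χ R 0 < 0) :
    ∃ D < 0, HasDerivAt (jostWronskian φ ψ) D l := by
  have hζ := ofReal_mem_halfPlane.2 hl
  have hE := isEigenfunction_of_jostWronskian_eq_zero hP hφ hψ hζ
    ((jostWronskian_eq_zero_iff hP hφ hψ hζ).2 ⟨χ, hχ⟩)
  obtain ⟨m, hm⟩ := hχ.exists_eq_smul hP hζ hE.isSolution (hE.isBoundedOn _)
  obtain ⟨k, hk⟩ := hE.exists_eq_smul_reflect hP hζ (hψ.isSolution l hζ) (hψ.isBoundedOn l hζ)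
  have hmχ : m * χ R 0 = 1 := by rw [← hφ.apply_zero l hζ, hm, Pi.smul_apply, Pi.smul_apply,
    smul_eq_mul]
  have hkφ : k * φ l (-R) 0 = 1 := by
    simpa [reflect, hψ.apply_zero l hζ] using (congrFun (congrFun hk (-R)) 0).symm
  have hkneg : k < 0 := by
    rw [eq_inv_of_mul_eq_one_left hkφ, hm, Pi.smul_apply, Pi.smul_apply, smul_eq_mul,
      eq_inv_of_mul_eq_one_left hmχ, inv_mul_eq_div]
    rw [← neg_pos, ← inv_neg]
    exact RCLike.inv_pos.2 (neg_pos.2 hsign)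
  have hconj : ∀ x, conj (φ l x 0) = φ l x 0 := fun x => congrFun (congrFun
    (hE.isSolution.star_eq_self hP hl (hE.isBoundedOn _) (hφ.apply_zero l hζ)) x) 0
  have hint := hE.integral_star_mul_self_pos hP hζ
  simp only [hconj] at hint
  exact ⟨_, mul_neg_of_neg_of_pos hkneg hint, hasDerivAt_jostWronskian hP hφ hψ hζ hE hk⟩

/-- On the real axis the Jost wronskian decreases through its zero at `l`, yet it is positive for
large spectral parameters. -/
theorem IsEigenfunction.exists_isEigenfunction_gt {χ : ℝ → Fin 2 → ℂ}
    (hχ : IsEigenfunction a l χ) (hP : IsCoercivePotential a Λ A c R) (hl : Λ < l)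
    (hsign : χ (-R) 0 / χ R 0 < 0) : ∃ l' : ℝ, l < l' ∧ ∃ χ', IsEigenfunction a l' χ' := by
  obtain ⟨φ, hφ⟩ := exists_isJostFamily hP
  obtain ⟨ψ, hψ⟩ := exists_isJostFamily hP.comp_neg
  obtain ⟨D, hD, hderiv⟩ := exists_hasDerivAt_jostWronskian_neg hχ hP hφ hψ hl hsign
  have hzero : jostWronskian φ ψ l = 0 :=
    (jostWronskian_eq_zero_iff hP hφ hψ (ofReal_mem_halfPlane.2 hl)).2 ⟨χ, hχ⟩
  have hsmall : ∀ᶠ x : ℝ in 𝓝 l,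
      SignType.sign (jostWronskian φ ψ x).re = SignType.sign (l - x) :=
    eventually_nhdsWithin_sign_eq_of_deriv_neg
      (hderiv.real_of_complex.deriv.trans_lt (Complex.neg_iff.1 hD).1) (by simp [hzero])
  set t := max (A + 2) (l + 1)
  have hlt : l < t := (lt_add_one l).trans_le (le_max_right _ _)
  have hAt : A + 1 < t := by linarith [le_max_left (A + 2) (l + 1)]
  obtain ⟨ε, hε, hlε, hεt⟩ := ((hsmall.filter_mono nhdsWithin_le_nhds).and
    (Ioo_mem_nhdsGT hlt)).exists
  have hneg : (jostWronskian φ ψ ε).re < 0 := by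
    rwa [sign_neg (sub_neg.2 hlε), sign_eq_neg_one_iff] at hε
  have hpos : 0 < jostWronskian φ ψ t := jostWronskian_pos hP hφ hψ (hl.trans hlt) hAt
  obtain ⟨l', hl', hl'0⟩ := intermediate_value_Icc hεt.le
    (f := fun x : ℝ => (jostWronskian φ ψ x).re) (fun x hx =>
      (Complex.continuous_re.continuousAt.comp ((analyticOnNhd_jostWronskian hP hφ hψ x
        (ofReal_mem_halfPlane.2 (hl.trans (hlε.trans_le hx.1)))).continuousAt.comp
          Complex.continuous_ofReal.continuousAt)).continuousWithinAt)
    ⟨hneg.le, (Complex.pos_iff.1 hpos).1.le⟩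
  have hll' : l < l' := hlε.trans_le hl'.1
  refine ⟨l', hll', (jostWronskian_eq_zero_iff hP hφ hψ
    (ofReal_mem_halfPlane.2 (hl.trans hll'))).1 (Complex.ext hl'0 ?_)⟩
  exact jostWronskian_im_eq_zero hP hφ hψ (hl.trans hll')

end LargerEigenvalue

section Homoclinic

lemma exists_norm_le_of_tendsto_cocompact {X E : Type*} [TopologicalSpace X]
    [SeminormedAddCommGroup E] {f : X → E} {L : E} (hf : Continuous f)
    (h : Tendsto f (cocompact X) (𝓝 L)) : ∃ C, ∀ x, ‖f x‖ ≤ C := by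
  obtain ⟨C, hC⟩ := (h.isCompact_insert_range_of_cocompact hf).isBounded.exists_norm_le
  exact ⟨C, fun x => hC _ (mem_insert_of_mem _ (mem_range_self x))⟩

lemma mul_pos_of_forall_ne_zero {X : Type*} [TopologicalSpace X] {s : Set X} {f : X → ℝ}
    (hs : IsPreconnected s) (hf : ContinuousOn f s) (hne : ∀ x ∈ s, f x ≠ 0) {x y : X}
    (hx : x ∈ s) (hy : y ∈ s) : 0 < f x * f y := by
  by_contra! h
  obtain ⟨z, hz, hz0⟩ : (0 : ℝ) ∈ f '' s := by
    rcases mul_nonpos_iff.1 h with ⟨h₁, h₂⟩ | ⟨h₁, h₂⟩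
    · exact hs.intermediate_value hy hx hf ⟨h₂, h₁⟩
    · exact hs.intermediate_value hx hy hf ⟨h₁, h₂⟩
  exact hne z hz hz0

namespace IsHomoclinic

variable {V : Set ℝ} {g v q : ℝ → ℝ}

lemma continuous_v (h : IsHomoclinic V g v q) : Continuous v :=
  continuous_iff_continuousAt.2 fun x => (h.hasDerivAt_v x).continuousAt

lemma continuous_q (h : IsHomoclinic V g v q) : Continuous q :=
  continuous_iff_continuousAt.2 fun x => (h.hasDerivAt_q x).continuousAt

lemma tendsto_v_cocompact (h : IsHomoclinic V g v q) : Tendsto v (cocompact ℝ) (𝓝 0) := by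
  rw [cocompact_eq_atBot_atTop]
  exact h.v_atBot.sup h.v_atTop

lemma tendsto_q_cocompact (h : IsHomoclinic V g v q) : Tendsto q (cocompact ℝ) (𝓝 0) := by
  rw [cocompact_eq_atBot_atTop]
  exact h.q_atBot.sup h.q_atTop

lemma exists_v_ne_zero (h : IsHomoclinic V g v q) : ∃ x, v x ≠ 0 := by
  by_contra! h0
  obtain ⟨x, hx⟩ := h.nontrivial
  exact hx (Prod.ext (h0 x) ((h.hasDerivAt_v x).unique
    ((hasDerivAt_const x (0 : ℝ)).congr_of_eventuallyEq (.of_forall h0))))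

lemma not_forall_mul_nonneg (h : IsHomoclinic V g v q) {k : ℝ} (hk : k ≠ 0) :
    ¬ ∀ x, 0 ≤ k * q x := by
  intro hq
  have hmono : Monotone fun x => k * v x :=
    monotone_of_hasDerivAt_nonneg (fun x => (h.hasDerivAt_v x).const_mul k) hq
  have htop := h.v_atTop.const_mul k
  have hbot := h.v_atBot.const_mul k
  rw [mul_zero] at htop hbot
  obtain ⟨x, hx⟩ := h.exists_v_ne_zero
  exact mul_ne_zero hk hx (le_antisymm (hmono.ge_of_tendsto htop x) (hmono.le_of_tendsto hbot x))

lemma exists_lipschitzOnWith (h : IsHomoclinic V g v q) (hV : IsOpen V) (h0 : (0 : ℝ) ∈ V)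
    (hg : ContDiffOn ℝ 1 g V) : ∃ K, LipschitzOnWith K g (insert 0 (range v)) := by
  have hsub : insert 0 (range v) ⊆ V := insert_subset h0 (range_subset_iff.2 h.mem)
  have hloc : LocallyLipschitzOn (insert 0 (range v)) g := fun y hy => by
    obtain ⟨K, t, ht, hK⟩ := (hg.contDiffAt (hV.mem_nhds (hsub hy))).exists_lipschitzOnWith
    exact ⟨K, t, nhdsWithin_le_nhds ht, hK⟩
  exact hloc.exists_lipschitzOnWith_of_compact
    (h.tendsto_v_cocompact.isCompact_insert_range_of_cocompact h.continuous_v)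

lemma apply_reflect_eq (h : IsHomoclinic V g v q) (hV : IsOpen V) (h0 : (0 : ℝ) ∈ V)
    (hg : ContDiffOn ℝ 1 g V) {x₀ : ℝ} (hx₀ : q x₀ = 0) (x : ℝ) : v (2 * x₀ - x) = v x := by
  obtain ⟨K, hK⟩ := h.exists_lipschitzOnWith hV h0 hg
  have hv : ∀ x, v x ∈ insert 0 (range v) := fun x => mem_insert_of_mem _ (mem_range_self x)
  have hlip : LipschitzOnWith (max 1 (K * 1)) (fun z : ℝ × ℝ => (z.2, g z.1))
      (insert 0 (range v) ×ˢ univ) :=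
    LipschitzWith.prod_snd.lipschitzOnWith.prodMk
      (hK.comp LipschitzWith.prod_fst.lipschitzOnWith fun z hz => hz.1)
  have hreflect : ∀ x, HasDerivAt (fun x => (v (2 * x₀ - x), -q (2 * x₀ - x)))
      (-q (2 * x₀ - x), g (v (2 * x₀ - x))) x := fun x => by
    have hsub : HasDerivAt (fun x => 2 * x₀ - x) (-1) x := (hasDerivAt_id x).const_sub (2 * x₀)
    exact (((h.hasDerivAt_v (2 * x₀ - x)).comp x hsub).congr_deriv (mul_neg_one _)).prodMk
      (((h.hasDerivAt_q (2 * x₀ - x)).comp x hsub).neg.congr_deriv (by ring))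
  have heq := ODE_solution_unique_univ (v := fun (_ : ℝ) (z : ℝ × ℝ) => (z.2, g z.1))
    (t₀ := x₀) (fun _ => hlip) (fun x => ⟨hreflect x, hv _, mem_univ _⟩)
    (fun x => ⟨(h.hasDerivAt_v x).prodMk (h.hasDerivAt_q x), hv _, mem_univ _⟩)
    (by simp [two_mul, hx₀])
  exact congrArg Prod.fst (congrFun heq x)

/-- The orbit is symmetric about the zeros of its velocity, so that two of them would make it
periodic. -/
lemma velocity_zero_unique (h : IsHomoclinic V g v q) (hV : IsOpen V) (h0 : (0 : ℝ) ∈ V)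
    (hg : ContDiffOn ℝ 1 g V) {x₀ x₁ : ℝ} (hx₀ : q x₀ = 0) (hx₁ : q x₁ = 0) : x₀ = x₁ := by
  wlog hlt : x₀ < x₁ generalizing x₀ x₁
  · exact (not_lt.1 hlt).eq_or_lt.elim Eq.symm fun hlt' => (this hx₁ hx₀ hlt').symm
  have hperiodic : Function.Periodic v (2 * (x₁ - x₀)) := fun x => by
    rw [← h.apply_reflect_eq hV h0 hg hx₀ x, ← h.apply_reflect_eq hV h0 hg hx₁ (2 * x₀ - x)]
    congr 1
    ring
  obtain ⟨x, hx⟩ := h.exists_v_ne_zero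
  have hlim : Tendsto (fun n : ℕ => v (x + n * (2 * (x₁ - x₀)))) atTop (𝓝 0) :=
    h.v_atTop.comp (tendsto_atTop_add_const_left _ _
      (tendsto_natCast_atTop_atTop.atTop_mul_const (by linarith)))
  exact absurd (tendsto_nhds_unique
    (tendsto_const_nhds.congr fun n => (hperiodic.nat_mul n x).symm) hlim) hx

lemma exists_velocity_sign_change (h : IsHomoclinic V g v q) (hV : IsOpen V) (h0 : (0 : ℝ) ∈ V)
    (hg : ContDiffOn ℝ 1 g V) :
    ∃ x₀, (∀ x, x ≠ x₀ → q x ≠ 0) ∧ ∀ y z, y < x₀ → x₀ < z → q y * q z < 0 := by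
  have hsign : ∀ s : Set ℝ, IsPreconnected s → (∀ x ∈ s, q x ≠ 0) →
      ∀ x ∈ s, ∀ y ∈ s, 0 < q x * q y := fun s hs hne x hx y hy =>
    mul_pos_of_forall_ne_zero hs h.continuous_q.continuousOn hne hx hy
  obtain ⟨x₀, hx₀⟩ : ∃ x₀, q x₀ = 0 := by
    by_contra! hne
    exact h.not_forall_mul_nonneg (hne 0) fun x =>
      (hsign univ isPreconnected_univ (fun x _ => hne x) 0 trivial x trivial).le
  have hne : ∀ x, x ≠ x₀ → q x ≠ 0 := fun x hx hq =>
    hx (h.velocity_zero_unique hV h0 hg hq hx₀)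
  refine ⟨x₀, hne, fun y z hy hz => lt_of_not_ge fun hyz => ?_⟩
  refine h.not_forall_mul_nonneg (hne y hy.ne) fun x => ?_
  rcases lt_trichotomy x x₀ with hx | rfl | hx
  · exact (hsign (Iio x₀) isPreconnected_Iio (fun w hw => hne w (ne_of_lt hw)) y hy x hx).le
  · rw [hx₀, mul_zero]
  · have hzx := hsign (Ioi x₀) isPreconnected_Ioi (fun w hw => hne w (ne_of_gt hw)) z hz x hx
    exact nonneg_of_mul_nonneg_left ((mul_nonneg hyz hzx.le).trans_eq (by ring))
      (mul_self_pos.2 (hne z hz.ne'))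

lemma hasDerivAt_comp (h : IsHomoclinic V g v q) (hV : IsOpen V) (hg : ContDiffOn ℝ 1 g V)
    (x : ℝ) : HasDerivAt (fun x => g (v x)) (deriv g (v x) * q x) x :=
  ((hg.differentiableOn one_ne_zero).differentiableAt
    (hV.mem_nhds (h.mem x))).hasDerivAt.comp x (h.hasDerivAt_v x)

lemma isEigenfunction_deriv (h : IsHomoclinic V g v q) (hV : IsOpen V) (h0 : (0 : ℝ) ∈ V)
    (hg : ContDiffOn ℝ 1 g V) :
    IsEigenfunction (fun x => deriv g (v x)) 0 fun x => ![(q x : ℂ), (g (v x) : ℂ)] := by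
  have hsol : IsSolution (schrodingerMatrix (fun x => deriv g (v x)) 0)
      fun x => ![(q x : ℂ), (g (v x) : ℂ)] :=
    isSolution_schrodingerMatrix_iff.2 ⟨fun x => (h.hasDerivAt_q x).ofReal_comp,
      fun x => (h.hasDerivAt_comp hV hg x).ofReal_comp.congr_deriv (by simp)⟩
  have hg_tendsto : Tendsto (fun x => g (v x)) (cocompact ℝ) (𝓝 (g 0)) :=
    (hg.continuousOn.continuousAt (hV.mem_nhds h0)).tendsto.comp h.tendsto_v_cocompact
  have hlim : Tendsto (fun x => ![(q x : ℂ), (g (v x) : ℂ)]) (cocompact ℝ)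
      (𝓝 ![((0 : ℝ) : ℂ), (g 0 : ℂ)]) :=
    tendsto_pi_nhds.2 (Fin.forall_fin_two.2 ⟨h.tendsto_q_cocompact.ofReal, hg_tendsto.ofReal⟩)
  refine ⟨⟨hsol, exists_norm_le_of_tendsto_cocompact hsol.continuous hlim⟩, fun hzero => ?_⟩
  have hq : ∀ x, q x = 0 := fun x => Complex.ofReal_eq_zero.1 (congrFun (congrFun hzero x) 0)
  exact h.not_forall_mul_nonneg one_ne_zero fun x => by rw [hq, mul_zero]

lemma exists_isCoercivePotential (h : IsHomoclinic V g v q) (hV : IsOpen V) (h0 : (0 : ℝ) ∈ V)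
    (hg : ContDiffOn ℝ 1 g V) {Λ : ℝ} (hΛ : 0 < deriv g 0 + Λ) (ρ : ℝ) :
    ∃ A c R, ρ < R ∧ IsCoercivePotential (fun x => deriv g (v x)) Λ A c R := by
  have hderiv := hg.continuousOn_deriv_of_isOpen hV le_rfl
  have hcont : Continuous fun x => deriv g (v x) := continuous_iff_continuousAt.2 fun x =>
    (hderiv.continuousAt (hV.mem_nhds (h.mem x))).comp h.continuous_v.continuousAt
  have hlim : Tendsto (fun x => deriv g (v x)) (cocompact ℝ) (𝓝 (deriv g 0)) :=
    (hderiv.continuousAt (hV.mem_nhds h0)).tendsto.comp h.tendsto_v_cocompact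
  obtain ⟨A, hA⟩ := exists_norm_le_of_tendsto_cocompact hcont hlim
  obtain ⟨c, hc, hcΛ⟩ := exists_between (lt_min one_pos hΛ)
  obtain ⟨hc1, hcΛ⟩ := lt_min_iff.1 hcΛ
  have hlarge : ∀ᶠ x in comap abs atTop, c - Λ < deriv g (v x) := by
    rw [comap_abs_atTop, ← cocompact_eq_atBot_atTop]
    exact hlim.eventually_const_lt (by linarith)
  obtain ⟨R, hR, hR0, hρR⟩ := ((eventually_forall_ge_atTop.2 (eventually_comap.1 hlarge)).and
    ((eventually_ge_atTop 0).and (eventually_gt_atTop ρ))).exists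
  exact ⟨A, c, R, hρR, hcont, hA, hc, hc1.le, hR0, fun x hx => by
    linarith [hR _ hx x rfl]⟩

end IsHomoclinic

end Homoclinic

section FastLimitProblem

lemma mem_spectrum_of_sq_eq {κ μ : ℂ} (h : μ ^ 2 = κ) :
    μ ∈ spectrum ℂ (!![0, 1; κ, 0] : Matrix (Fin 2) (Fin 2) ℂ) := by
  rw [spectrum.mem_iff, Matrix.isUnit_iff_isUnit_det, isUnit_iff_ne_zero, not_not, det_fin_two,
    ← h]
  simp [Matrix.algebraMap_matrix_apply, sq]

variable {m : ℕ} {U : Set (EuclideanSpace ℝ (Fin m))} {V I : Set ℝ}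
  {G : EuclideanSpace ℝ (Fin m) → ℝ → ℝ → ℝ} {u : EuclideanSpace ℝ (Fin m)} {Λ : ℝ}

lemma UniformlyHyperbolic.deriv_add_pos (h : UniformlyHyperbolic G u Λ) :
    0 < deriv (fun w => G u w 0) 0 + Λ := by
  obtain ⟨δ, hδ, h⟩ := h
  set κ := deriv (fun w => G u w 0) 0
  by_contra! hle
  have hgap := h (((δ / 2) ^ 2 - κ : ℝ) : ℂ) (ofReal_mem_halfPlane.2 (by nlinarith))
    ((δ / 2 : ℝ) : ℂ) (mem_spectrum_of_sq_eq (by push_cast; ring))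
  rw [Complex.ofReal_re, abs_of_pos (half_pos hδ)] at hgap
  linarith

lemma ReactionTerm.contDiffOn_fast (hG : ReactionTerm U V I G) (hu : u ∈ U) :
    ContDiffOn ℝ 2 (fun w => G u w 0) V :=
  hG.contDiffOn.comp (contDiff_const.prodMk (contDiff_id.prodMk contDiff_const)).contDiffOn
    fun _ hw => ⟨hu, hw, hG.zero_mem_I⟩

end FastLimitProblem

end FastEvans

end

open scoped ComplexOrder in
open FastEvans in
theorem mainTheorem10_general {V : Set ℝ} {g v q : ℝ → ℝ} {Λ : ℝ} (hV : IsOpen V)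
    (h0 : (0 : ℝ) ∈ V) (hg : ContDiffOn ℝ 1 g V) (h : IsHomoclinic V g v q) (hΛ : Λ < 0)
    (hgΛ : 0 < deriv g 0 + Λ) :
    (∃ E, IsFastReducedEvans (schrodingerMatrix fun x => deriv g (v x)) Λ E) ∧
    ∀ E, IsFastReducedEvans (schrodingerMatrix fun x => deriv g (v x)) Λ E →
      (∀ ζ ∈ halfPlane Λ, E ζ = 0 → ζ.im = 0 ∧ analyticOrderAt E ζ = 1) ∧
      (∃ l₀ : ℝ, 0 < l₀ ∧ E l₀ = 0 ∧ (∀ l : ℝ, 0 < l → E l = 0 → l = l₀) ∧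
        ∀ φ ∈ boundedSolutions (schrodingerMatrix (fun x => deriv g (v x)) l₀),
          φ ≠ 0 → ∀ x, φ x 0 ≠ 0) ∧
      E 0 = 0 ∧
      Submodule.span ℂ {fun x => ![((deriv v x : ℝ) : ℂ), ((deriv q x : ℝ) : ℂ)]} =
        boundedSolutions (schrodingerMatrix (fun x => deriv g (v x)) 0) := by
  obtain ⟨x₀, hne, hsign⟩ := h.exists_velocity_sign_change hV h0 hg
  obtain ⟨A, c, R, hR, hP⟩ := h.exists_isCoercivePotential hV h0 hg hgΛ |x₀|
  have hE₀ : IsEigenfunction (fun x => deriv g (v x)) ((0 : ℝ) : ℂ)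
    fun x => ![(q x : ℂ), (g (v x) : ℂ)] := h.isEigenfunction_deriv hV h0 hg
  have hflip : (q (-R) : ℂ) / q R < 0 := by
    exact_mod_cast div_neg_iff.2 (mul_neg_iff.1
      (hsign (-R) R (neg_lt_of_abs_lt hR) (lt_of_abs_lt hR)))
  have hpos : ∀ l : ℝ, 0 < l → (l : ℂ) ∈ halfPlane Λ := fun l hl =>
    ofReal_mem_halfPlane.2 (hΛ.trans hl)
  have hground : ∀ l : ℝ, 0 < l → ∀ φ, IsEigenfunction (fun x => deriv g (v x)) l φ →
      ∀ x, φ x 0 ≠ 0 := fun l hl φ hφ =>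
    hE₀.apply_zero_ne_zero_of_lt hφ hP hΛ hl fun x hx => Complex.ofReal_ne_zero.2 (hne x hx)
  refine ⟨exists_isFastReducedEvans hP, fun E hE => ⟨fun ζ hζ hEζ => ?_, ?_, ?_, ?_⟩⟩
  · obtain ⟨φ, hφ⟩ := (hE.eq_zero_iff hP hζ).1 hEζ
    exact ⟨Complex.conj_eq_iff_im.1 (hφ.conj_eq_self hP hζ), hE.analyticOrderAt_eq_one hP hζ hEζ⟩
  · obtain ⟨l₀, hl₀, φ₀, hφ₀⟩ := hE₀.exists_isEigenfunction_gt hP hΛ hflip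
    refine ⟨l₀, hl₀, (hE.eq_zero_iff hP (hpos l₀ hl₀)).2 ⟨φ₀, hφ₀⟩, fun l hl hEl => ?_,
      fun φ hφ hφ0 => hground l₀ hl₀ φ ⟨hφ, hφ0⟩⟩
    obtain ⟨φ, hφ⟩ := (hE.eq_zero_iff hP (hpos l hl)).1 hEl
    exact hφ.eq_of_apply_zero_ne_zero hφ₀ hP (hΛ.trans hl) (hΛ.trans hl₀)
      (hground l hl φ hφ) (hground l₀ hl₀ φ₀ hφ₀)
  · exact (hE.eq_zero_iff hP hΛ).2 ⟨_, hE₀⟩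
  · rw [funext fun x => (h.hasDerivAt_v x).deriv, funext fun x => (h.hasDerivAt_q x).deriv]
    exact hE₀.span_eq_boundedSolutions hP (ofReal_mem_halfPlane.2 hΛ)

theorem mainTheorem10 {m : ℕ} (U : Set (EuclideanSpace ℝ (Fin m))) (V I : Set ℝ)
    (G : EuclideanSpace ℝ (Fin m) → ℝ → ℝ → ℝ) (hG : FastEvans.ReactionTerm U V I G)
    (u₀ : EuclideanSpace ℝ (Fin m)) (hu₀ : u₀ ∈ U) (v_h q_h : ℝ → ℝ)
    (hh : FastEvans.IsHomoclinic V (fun v => G u₀ v 0) v_h q_h)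
    (Λ : ℝ) (hΛ : Λ < 0) (hyp : FastEvans.UniformlyHyperbolic G u₀ Λ) :
    (∃ E : ℂ → ℂ,
      FastEvans.IsFastReducedEvans (fun ζ x => FastEvans.fastMatrix G u₀ (v_h x) ζ) Λ E) ∧
    ∀ E : ℂ → ℂ,
      FastEvans.IsFastReducedEvans (fun ζ x => FastEvans.fastMatrix G u₀ (v_h x) ζ) Λ E →
      -- all zeros are real and simple
      (∀ ζ ∈ FastEvans.halfPlane Λ, E ζ = 0 → ζ.im = 0 ∧ analyticOrderAt E ζ = 1) ∧
      -- precisely one positive zero, and its bounded solutions have no zeros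
      (∃ l₀ : ℝ, 0 < l₀ ∧ E l₀ = 0 ∧ (∀ l : ℝ, 0 < l → E l = 0 → l = l₀) ∧
        ∀ φ ∈ FastEvans.boundedSolutions (fun x => FastEvans.fastMatrix G u₀ (v_h x) l₀),
          φ ≠ 0 → ∀ x, φ x 0 ≠ 0) ∧
      -- zero is a zero, and its bounded solutions are spanned by the derivative of the homoclinic
      E 0 = 0 ∧
      Submodule.span ℂ
          {fun x => ![((deriv v_h x : ℝ) : ℂ), ((deriv q_h x : ℝ) : ℂ)]} =
        FastEvans.boundedSolutions (fun x => FastEvans.fastMatrix G u₀ (v_h x) 0) :=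
  mainTheorem10_general hG.isOpen_V hG.zero_mem_V ((hG.contDiffOn_fast hu₀).of_le one_le_two) hh hΛ
    hyp.deriv_add_pos
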